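/- A two-receiver discrete memoryless broadcast channel consists of finite alphabets $\mathcal X,\mathcal Y_1,\mathcal Y_2$ and a transition probability $p(y_1,y_2|x)$; $n$ uses of the channel have transition probability $\prod_{i=1}^n p(y_{1i},y_{2i}|x_i)$. A pair $(R_1,R_2)$ with $R_1,R_2\ge 0$ is achievable if there is a sequence, over $n$, of codes with message sets of sizes $\lceil 2^{nR_1}\rceil$ and $\lceil 2^{nR_2}\rceil$, an encoder $\mathcal W_1\times\mathcal W_2\to\mathcal X^n$ and decoders $\mathcal Y_1^n\to\mathcal W_1$, $\mathcal Y_2^n\to\mathcal W_2$, such that, for $(W_1,W_2)$ uniform on $\mathcal W_1\times\mathcal W_2$, $\mathrm P(\hat W_1\ne W_1\text{ or }\hat W_2\ne W_2)\to 0$ as $n\to\infty$. The capacity region is the closure of the set of achievable pairs. All information quantities are in bits, and auxiliary random variables take finitely many values. A set $\mathcal P$ of probability distributions on $\mathcal X$ is a *sufficient class* if for every triple $(U,V,X)$ with law $p(u,v,x)$ there is a triple with law $q(u,v,x)$ (the alphabets of its auxiliary variables $U,V$ may be different) such that $q(x)\in\mathcal P$ and, for $i=1,2$, $$I(U;Y_i)_p\le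 I(U;Y_i)_q,\quad I(V;Y_i)_p\le I(V;Y_i)_q,\quad I(X;Y_i|U)_p\le I(X;Y_i|U)_q,\quad I(X;Y_i|V)_p\le I(X;Y_i|V)_q,\quad I(X;Y_i)_p\le I(X;Y_i)_q,$$ where $(U,V)\to X\to(Y_1,Y_2)$ is a Markov chain in which $(Y_1,Y_2)$ is the output of the channel with input $X$. The class $\mathcal P$ *makes $Y_1$ essentially more capable than $Y_2$* if it is a sufficient class and $I(X;Y_2|U)\le I(X;Y_1|U)$ for all Markov chains $U\to X\to(Y_1,Y_2)$ with $p(x)\in\mathcal P$. **Theorem.** Suppose $Y_1$ is essentially more capable than $Y_2$, and let $\mathcal P$ be any sufficient class that makes $Y_1$ essentially more capable than $Y_2$. Then the capacity region of the broadcast channel is equal to the set of all pairs $(R_1,R_2)$ with $R_1,R_2\ge 0$ such that $$R_2\le I(U;Y_2),\qquad R_1+R_2\le I(U;Y_2)+I(X;Y_1|U),\qquad R_1+R_2\le I(X;Y_1)$$ for some Markov chain $U\to X\to(Y_1,Y_2)$ with $p(x)\in\mathcal P$. -/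

import Mathlib

open Filter Topology

noncomputable section

/-! Entropies (in bits) of finitely valued random variables on a finite probability space.
A probability mass function on a finite type `Ω` is an element of `stdSimplex ℝ Ω`. -/

open Classical in
/-- The law of the random variable `f : Ω → α` when the sample point has mass function `P`. -/
def lawOf {Ω α : Type*} [Fintype Ω] (P : Ω → ℝ) (f : Ω → α) : α → ℝ :=
  fun a => ∑ ω with f ω = a, P ω

/-- The Shannon entropy in bits, `H(f) = -∑ₐ P(f = a) log₂ P(f = a)`, with `0 log₂ 0 = 0`. -/
def entropy {Ω α : Type*} [Fintype Ω] [Fintype α] (P : Ω → ℝ) (f : Ω → α) : ℝ :=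
  -∑ a, lawOf P f a * Real.logb 2 (lawOf P f a)

/-- The mutual information `I(f; g) = H(f) + H(g) - H(f, g)` in bits. -/
def mutualInfo {Ω α β : Type*} [Fintype Ω] [Fintype α] [Fintype β]
    (P : Ω → ℝ) (f : Ω → α) (g : Ω → β) : ℝ :=
  entropy P f + entropy P g - entropy P (fun ω => (f ω, g ω))

/-- The conditional mutual information `I(f; g | h) = H(f, h) + H(g, h) - H(f, g, h) - H(h)`
in bits. -/
def condMutualInfo {Ω α β γ : Type*} [Fintype Ω] [Fintype α] [Fintype β] [Fintype γ]
    (P : Ω → ℝ) (f : Ω → α) (g : Ω → β) (h : Ω → γ) : ℝ :=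
  entropy P (fun ω => (f ω, h ω)) + entropy P (fun ω => (g ω, h ω))
    - entropy P (fun ω => (f ω, g ω, h ω)) - entropy P h

/-- A two-receiver broadcast channel: the transition probabilities `p(y₁, y₂ | x)`. -/
structure BroadcastChannel (X Y₁ Y₂ : Type*) [Fintype Y₁] [Fintype Y₂] where
  /-- `prob x (y₁, y₂)` is `p(y₁, y₂ | x)`. -/
  prob : X → Y₁ × Y₂ → ℝ
  prob_mem : ∀ x, prob x ∈ stdSimplex ℝ (Y₁ × Y₂)

/-- A code of block length `n` with message sets of sizes `M₁` and `M₂`. -/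
structure BroadcastCode (X Y₁ Y₂ : Type*) (M₁ M₂ n : ℕ) where
  encoder : Fin M₁ → Fin M₂ → Fin n → X
  decoder₁ : (Fin n → Y₁) → Fin M₁
  decoder₂ : (Fin n → Y₂) → Fin M₂

namespace BroadcastChannel

section Capacity

variable {X Y₁ Y₂ : Type*} [Fintype Y₁] [Fintype Y₂]

/-- The probability that at least one receiver decodes its message wrongly, when the message pair
is uniformly distributed and the channel is used `n` times without memory. -/
def errorProb (W : BroadcastChannel X Y₁ Y₂) {M₁ M₂ n : ℕ} (c : BroadcastCode X Y₁ Y₂ M₁ M₂ n) :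
    ℝ :=
  (1 / ((M₁ : ℝ) * (M₂ : ℝ))) * ∑ w₁ : Fin M₁, ∑ w₂ : Fin M₂, ∑ y : Fin n → Y₁ × Y₂,
    if c.decoder₁ (fun i => (y i).1) ≠ w₁ ∨ c.decoder₂ (fun i => (y i).2) ≠ w₂ then
      ∏ i, W.prob (c.encoder w₁ w₂ i) (y i)
    else 0

/-- The rate pair `(R₁, R₂)` is achievable: there are `((2^{nR₁}, 2^{nR₂}), n)` codes, with the
sizes of the message sets rounded up to integers, whose error probabilities tend to zero. -/
def Achievable (W : BroadcastChannel X Y₁ Y₂) (R : ℝ × ℝ) : Prop :=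
  0 ≤ R.1 ∧ 0 ≤ R.2 ∧
    ∃ c : ∀ n : ℕ, BroadcastCode X Y₁ Y₂
        ⌈(2 : ℝ) ^ ((n : ℝ) * R.1)⌉₊ ⌈(2 : ℝ) ^ ((n : ℝ) * R.2)⌉₊ n,
      Tendsto (fun n => W.errorProb (c n)) atTop (𝓝 0)

/-- The capacity region: the closure of the set of achievable rate pairs. -/
def capacityRegion (W : BroadcastChannel X Y₁ Y₂) : Set (ℝ × ℝ) :=
  closure {R | W.Achievable R}

/-- The joint mass function of `(A, X, Y₁, Y₂)` when `(A, X)` has mass function `p` and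
`A → X → (Y₁, Y₂)` is a Markov chain governed by the channel. -/
def joint {A : Type*} (W : BroadcastChannel X Y₁ Y₂) (p : A × X → ℝ) :
    (A × X) × (Y₁ × Y₂) → ℝ :=
  fun ω => p ω.1 * W.prob ω.1.2 ω.2

end Capacity

section Information

variable {X Y₁ Y₂ : Type*} [Fintype X] [Fintype Y₁] [Fintype Y₂] {A B : Type*} [Fintype A]
  [Fintype B]

/-- `I(B; Y₁)`, where `B = b A` is a function of the auxiliary variable `A` and `(A, X)` has mass
function `p`. -/
def auxInfo₁ (W : BroadcastChannel X Y₁ Y₂) (p : A × X → ℝ) (b : A → B) : ℝ :=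
  mutualInfo (W.joint p) (fun ω => b ω.1.1) (fun ω => ω.2.1)

/-- `I(B; Y₂)`, where `B = b A`. -/
def auxInfo₂ (W : BroadcastChannel X Y₁ Y₂) (p : A × X → ℝ) (b : A → B) : ℝ :=
  mutualInfo (W.joint p) (fun ω => b ω.1.1) (fun ω => ω.2.2)

/-- `I(X; Y₁ | B)`, where `B = b A`. -/
def condInfo₁ (W : BroadcastChannel X Y₁ Y₂) (p : A × X → ℝ) (b : A → B) : ℝ :=
  condMutualInfo (W.joint p) (fun ω => ω.1.2) (fun ω => ω.2.1) (fun ω => b ω.1.1)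

/-- `I(X; Y₂ | B)`, where `B = b A`. -/
def condInfo₂ (W : BroadcastChannel X Y₁ Y₂) (p : A × X → ℝ) (b : A → B) : ℝ :=
  condMutualInfo (W.joint p) (fun ω => ω.1.2) (fun ω => ω.2.2) (fun ω => b ω.1.1)

/-- `I(X; Y₁)`. -/
def inputInfo₁ (W : BroadcastChannel X Y₁ Y₂) (p : A × X → ℝ) : ℝ :=
  mutualInfo (W.joint p) (fun ω => ω.1.2) (fun ω => ω.2.1)

/-- `I(X; Y₂)`. -/
def inputInfo₂ (W : BroadcastChannel X Y₁ Y₂) (p : A × X → ℝ) : ℝ :=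
  mutualInfo (W.joint p) (fun ω => ω.1.2) (fun ω => ω.2.2)

/-- `D` is a sufficient class of input distributions: every triple `(U, V, X)` is dominated, in
the ten listed information quantities, by one whose input distribution lies in `D`. The auxiliary
variables `U = Prod.fst A` and `V = Prod.snd A` range over finite alphabets, and those of the
dominating triple may differ from the given ones. -/
def IsSufficientClass (W : BroadcastChannel X Y₁ Y₂) (D : Set (X → ℝ)) : Prop :=
  D ⊆ stdSimplex ℝ X ∧
    ∀ (k l : ℕ) (p : (Fin k × Fin l) × X → ℝ), p ∈ stdSimplex ℝ ((Fin k × Fin l) × X) →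
      ∃ (k' l' : ℕ) (q : (Fin k' × Fin l') × X → ℝ),
        q ∈ stdSimplex ℝ ((Fin k' × Fin l') × X) ∧
        lawOf q Prod.snd ∈ D ∧
        W.auxInfo₁ p Prod.fst ≤ W.auxInfo₁ q Prod.fst ∧
        W.auxInfo₂ p Prod.fst ≤ W.auxInfo₂ q Prod.fst ∧
        W.auxInfo₁ p Prod.snd ≤ W.auxInfo₁ q Prod.snd ∧
        W.auxInfo₂ p Prod.snd ≤ W.auxInfo₂ q Prod.snd ∧
        W.condInfo₁ p Prod.fst ≤ W.condInfo₁ q Prod.fst ∧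
        W.condInfo₂ p Prod.fst ≤ W.condInfo₂ q Prod.fst ∧
        W.condInfo₁ p Prod.snd ≤ W.condInfo₁ q Prod.snd ∧
        W.condInfo₂ p Prod.snd ≤ W.condInfo₂ q Prod.snd ∧
        W.inputInfo₁ p ≤ W.inputInfo₁ q ∧
        W.inputInfo₂ p ≤ W.inputInfo₂ q

/-- `D` is a sufficient class that makes `Y₁` essentially more capable than `Y₂`:
`I(X; Y₂ | U) ≤ I(X; Y₁ | U)` for all `U → X → (Y₁, Y₂)` with `p(x) ∈ D`. -/
def EssentiallyMoreCapableOn (W : BroadcastChannel X Y₁ Y₂) (D : Set (X → ℝ)) : Prop :=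
  W.IsSufficientClass D ∧
    ∀ (k : ℕ) (p : Fin k × X → ℝ), p ∈ stdSimplex ℝ (Fin k × X) →
      lawOf p Prod.snd ∈ D → W.condInfo₂ p id ≤ W.condInfo₁ p id

/-- The union, over all `U → X → (Y₁, Y₂)` with `U` finitely valued and `p(x) ∈ D`, of the sets of
rate pairs with `R₂ ≤ I(U; Y₂)`, `R₁ + R₂ ≤ I(U; Y₂) + I(X; Y₁ | U)`, `R₁ + R₂ ≤ I(X; Y₁)`. -/
def superpositionRegion (W : BroadcastChannel X Y₁ Y₂) (D : Set (X → ℝ)) : Set (ℝ × ℝ) :=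
  {R | 0 ≤ R.1 ∧ 0 ≤ R.2 ∧
    ∃ (k : ℕ) (p : Fin k × X → ℝ), p ∈ stdSimplex ℝ (Fin k × X) ∧ lawOf p Prod.snd ∈ D ∧
      R.2 ≤ W.auxInfo₂ p id ∧
      R.1 + R.2 ≤ W.auxInfo₂ p id + W.condInfo₁ p id ∧
      R.1 + R.2 ≤ W.inputInfo₁ p}

end Information

end BroadcastChannel

end

/-! The region is squeezed between superposition coding and a single-letter outer bound with two
auxiliaries.

Direct part. Around i.i.d. cloud centers `u` one draws satellite codewords `x`. The cloud carries
the second message and part of the first: this rate splitting is what turns the constraint on the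
satellites into the sum constraint `R₁ + R₂ ≤ I(U;Y₂) + I(X;Y₁|U)`. Receiver 2 finds the cloud (cost
`I(U;Y₂)`). Receiver 1 finds the codeword; satellites of the true cloud cost `I(X;Y₁|U)`, all others
`I(X;Y₁)`. Both receivers use threshold tests on likelihood ratios, so Chebyshev's inequality and a
change of measure suffice: `exists_superposition_code`, `exists_code_errorProb_le`,
`achievable_of_lt`.

Converse. With `Uᵢ = (W₂, Y₁ before i, Y₂ after i)` and `Vᵢ = (W₁, Y₁ before i, Y₂ after i)`, Fano's
inequality and the Csiszár sum identity give, for every code and up to vanishing terms, `R₂ ≤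
I(U;Y₂)`, `R₁ + R₂ ≤ I(U;Y₂) + I(X;Y₁|U)` and `R₁ + R₂ ≤ I(V;Y₁) + I(X;Y₂|V)`
(`exists_entropyHull_of_code`). Passing to the limit needs compactness. It comes from viewing the
triples `(p(x), H(Y₁|U), H(Y₂|U))` as the convex hull of a compact set in finite dimension.

Conclusion. Sufficiency replaces `(U,V,X)` by a triple whose input law lies in the class, without
decreasing any right-hand side. There `I(X;Y₂|V) ≤ I(X;Y₁|V)`, so the third bound is at most
`I(V;Y₁) + I(X;Y₁|V) = I(X;Y₁)`, and `V` disappears. -/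

namespace FiniteEntropy

/-! ### Laws, entropy and the basic entropy inequalities. -/

section Laws

variable {Ω α β γ : Type*} [Fintype Ω]

theorem lawOf_nonneg {P : Ω → ℝ} (hP : ∀ ω, 0 ≤ P ω) (f : Ω → α) (a : α) : 0 ≤ lawOf P f a :=
  Finset.sum_nonneg fun ω _ => hP ω

theorem le_lawOf {P : Ω → ℝ} (hP : ∀ ω, 0 ≤ P ω) (f : Ω → α) (ω : Ω) :
    P ω ≤ lawOf P f (f ω) := by
  classical
  exact Finset.single_le_sum (f := P) (fun ω _ => hP ω) (by simp)

theorem lawOf_pos {P : Ω → ℝ} (hP : ∀ ω, 0 ≤ P ω) (f : Ω → α) {ω : Ω} (h : P ω ≠ 0) :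
    0 < lawOf P f (f ω) :=
  ((hP ω).lt_of_ne' h).trans_le (le_lawOf hP f ω)

theorem sum_lawOf_mul [Fintype α] (P : Ω → ℝ) (f : Ω → α) (φ : α → ℝ) :
    ∑ a, lawOf P f a * φ a = ∑ ω, P ω * φ (f ω) := by
  classical
  rw [← Finset.sum_fiberwise_of_maps_to (s := Finset.univ) (t := Finset.univ) (g := f) (by simp)]
  refine Finset.sum_congr rfl fun a _ => ?_
  rw [lawOf, Finset.sum_mul]
  refine Finset.sum_congr (by ext; simp) fun ω hω => ?_
  rw [(Finset.mem_filter.1 hω).2]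

theorem sum_lawOf [Fintype α] (P : Ω → ℝ) (f : Ω → α) : ∑ a, lawOf P f a = ∑ ω, P ω := by
  simpa using sum_lawOf_mul P f fun _ => 1

theorem lawOf_mem_stdSimplex [Fintype α] {P : Ω → ℝ} (hP : P ∈ stdSimplex ℝ Ω) (f : Ω → α) :
    lawOf P f ∈ stdSimplex ℝ α :=
  ⟨fun a => lawOf_nonneg hP.1 f a, by rw [sum_lawOf, hP.2]⟩

open Classical in
theorem lawOf_eq_sum_ite (P : Ω → ℝ) (f : Ω → α) (a : α) :
    lawOf P f a = ∑ ω, if f ω = a then P ω else 0 := by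
  rw [lawOf, Finset.sum_filter]

theorem lawOf_lawOf [Fintype α] (P : Ω → ℝ) (f : Ω → α) (g : α → β) :
    lawOf (lawOf P f) g = lawOf P (fun ω => g (f ω)) := by
  classical
  ext b
  rw [lawOf_eq_sum_ite, lawOf_eq_sum_ite]
  have := sum_lawOf_mul P f fun a => if g a = b then 1 else 0
  simpa using this

theorem lawOf_fst [Fintype α] [Fintype β] (P : α × β → ℝ) (a : α) :
    lawOf P Prod.fst a = ∑ b, P (a, b) := by
  classical
  rw [lawOf_eq_sum_ite, Fintype.sum_prod_type_right]
  simp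

theorem lawOf_snd [Fintype α] [Fintype β] (P : α × β → ℝ) (b : β) :
    lawOf P Prod.snd b = ∑ a, P (a, b) := by
  classical
  rw [lawOf_eq_sum_ite, Fintype.sum_prod_type]
  simp

end Laws

section Entropy

variable {Ω α β γ : Type*} [Fintype Ω] [Fintype α] [Fintype β] [Fintype γ]

theorem entropy_eq_sum (P : Ω → ℝ) (f : Ω → α) :
    entropy P f = -∑ ω, P ω * Real.logb 2 (lawOf P f (f ω)) := by
  rw [entropy, sum_lawOf_mul P f fun a => Real.logb 2 (lawOf P f a)]

/-- The entropy depends only on the partition of the sample space. -/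
theorem entropy_congr (P : Ω → ℝ) {f : Ω → α} {g : Ω → β}
    (h : ∀ ω ω', f ω = f ω' ↔ g ω = g ω') : entropy P f = entropy P g := by
  rw [entropy_eq_sum, entropy_eq_sum]
  congr 1
  refine Finset.sum_congr rfl fun ω _ => ?_
  congr 2
  exact Finset.sum_congr (by ext ω'; simp [h]) fun _ _ => rfl

theorem entropy_lawOf (P : Ω → ℝ) (f : Ω → α) (g : α → β) :
    entropy (lawOf P f) g = entropy P (fun ω => g (f ω)) := by
  simp only [entropy, lawOf_lawOf]

/-- Gibbs' inequality. -/
theorem entropy_le_cross {P : Ω → ℝ} (hP : P ∈ stdSimplex ℝ Ω) (f : Ω → α) (q : α → ℝ)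
    (hq : ∀ a, 0 ≤ q a) (hq1 : ∑ a, q a ≤ 1) (hpos : ∀ ω, P ω ≠ 0 → 0 < q (f ω)) :
    entropy P f ≤ -∑ ω, P ω * Real.logb 2 (q (f ω)) := by
  rw [entropy_eq_sum, neg_le_neg_iff, ← sub_nonneg, ← Finset.sum_sub_distrib]
  have hlog : 0 < Real.log 2 := Real.log_pos one_lt_two
  have key : ∀ ω, P ω * (1 - q (f ω) / lawOf P f (f ω)) / Real.log 2 ≤
      P ω * Real.logb 2 (lawOf P f (f ω)) - P ω * Real.logb 2 (q (f ω)) := by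
    intro ω
    by_cases h : P ω = 0
    · simp [h]
    have h1 := lawOf_pos hP.1 f h
    have h2 := hpos ω h
    rw [← mul_sub, mul_div_assoc]
    refine mul_le_mul_of_nonneg_left ?_ (hP.1 ω)
    rw [← Real.logb_div h1.ne' h2.ne', Real.logb]
    gcongr
    -- The inequality `1 - 1/t ≤ log t` at `t = P(f = a) / q a`; after summation the left side
    -- becomes `1 - ∑ q ≥ 0`.
    have := Real.one_sub_inv_le_log_of_pos (div_pos h1 h2)
    rwa [inv_div] at this
  refine le_trans ?_ (Finset.sum_le_sum fun ω _ => key ω)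
  rw [← Finset.sum_div]
  refine div_nonneg ?_ hlog.le
  simp only [mul_sub, mul_one, Finset.sum_sub_distrib, hP.2]
  rw [← sum_lawOf_mul P f fun a => q a / lawOf P f a, sub_nonneg]
  refine le_trans (Finset.sum_le_sum fun a _ => ?_) hq1
  rcases eq_or_ne (lawOf P f a) 0 with h | h
  · simpa [h] using hq a
  · exact (mul_div_cancel₀ _ h).le

theorem sum_pair_left (P : Ω → ℝ) (f : Ω → α) (h : Ω → γ) (c : γ) :
    ∑ a, lawOf P (fun ω => (f ω, h ω)) (a, c) = lawOf P h c := by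
  have : lawOf P h = lawOf (lawOf P fun ω => (f ω, h ω)) Prod.snd := by rw [lawOf_lawOf]
  rw [this, lawOf_snd]

/-- Submodularity: conditional mutual information is nonnegative. -/
theorem entropy_submodular {P : Ω → ℝ} (hP : P ∈ stdSimplex ℝ Ω) (f : Ω → α) (g : Ω → β)
    (h : Ω → γ) :
    entropy P (fun ω => (f ω, g ω, h ω)) + entropy P h ≤
      entropy P (fun ω => (f ω, h ω)) + entropy P (fun ω => (g ω, h ω)) := by
  -- The comparison law makes `f` and `g` conditionally independent given `h`.
  have key := entropy_le_cross hP (fun ω => (f ω, g ω, h ω))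
    (fun t => lawOf P (fun ω => (f ω, h ω)) (t.1, t.2.2) *
      lawOf P (fun ω => (g ω, h ω)) (t.2.1, t.2.2) / lawOf P h t.2.2)
    (fun t => div_nonneg (mul_nonneg (lawOf_nonneg hP.1 _ _) (lawOf_nonneg hP.1 _ _))
      (lawOf_nonneg hP.1 _ _)) ?_ ?_
  · have e : ∀ ω, P ω * Real.logb 2 (lawOf P (fun ω => (f ω, h ω)) (f ω, h ω) *
        lawOf P (fun ω => (g ω, h ω)) (g ω, h ω) / lawOf P h (h ω)) =
        P ω * Real.logb 2 (lawOf P (fun ω => (f ω, h ω)) (f ω, h ω)) +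
        P ω * Real.logb 2 (lawOf P (fun ω => (g ω, h ω)) (g ω, h ω)) -
        P ω * Real.logb 2 (lawOf P h (h ω)) := by
      intro ω
      by_cases h0 : P ω = 0
      · simp [h0]
      have h1 := lawOf_pos hP.1 (fun ω => (f ω, h ω)) h0
      have h2 := lawOf_pos hP.1 (fun ω => (g ω, h ω)) h0
      have h3 := lawOf_pos hP.1 h h0
      rw [Real.logb_div (mul_pos h1 h2).ne' h3.ne', Real.logb_mul h1.ne' h2.ne']
      ring
    simp only [e, Finset.sum_sub_distrib, Finset.sum_add_distrib] at key
    rw [entropy_eq_sum P fun ω => (f ω, h ω), entropy_eq_sum P fun ω => (g ω, h ω),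
      entropy_eq_sum P h]
    linarith
  · rw [Fintype.sum_prod_type]
    simp only [Fintype.sum_prod_type]
    calc _ = ∑ c, ∑ a, ∑ b, lawOf P (fun ω => (f ω, h ω)) (a, c) *
            lawOf P (fun ω => (g ω, h ω)) (b, c) / lawOf P h c := by
          rw [Finset.sum_comm' (t' := Finset.univ) (s' := fun _ => Finset.univ) (by simp)]
          refine (Finset.sum_congr rfl fun b _ => Finset.sum_comm).trans ?_
          rw [Finset.sum_comm]
          exact Finset.sum_congr rfl fun c _ => Finset.sum_comm
      _ = ∑ c, lawOf P h c * lawOf P h c / lawOf P h c := by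
          refine Finset.sum_congr rfl fun c _ => ?_
          rw [← sum_pair_left P f h c, Finset.sum_mul, Finset.sum_div]
          refine Finset.sum_congr rfl fun a _ => ?_
          rw [sum_pair_left P f h c, ← sum_pair_left P g h c, Finset.mul_sum, Finset.sum_div]
      _ = ∑ c, lawOf P h c := by simp
      _ ≤ 1 := by rw [sum_lawOf, hP.2]
  · intro ω h0
    exact div_pos (mul_pos (lawOf_pos hP.1 (fun ω => (f ω, h ω)) h0)
      (lawOf_pos hP.1 (fun ω => (g ω, h ω)) h0)) (lawOf_pos hP.1 h h0)

theorem entropy_of_subsingleton [Subsingleton α] {P : Ω → ℝ} (hP : P ∈ stdSimplex ℝ Ω)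
    (f : Ω → α) : entropy P f = 0 := by
  rw [entropy_eq_sum, neg_eq_zero]
  refine Finset.sum_eq_zero fun ω _ => ?_
  have : lawOf P f (f ω) = 1 := by
    classical
    rw [lawOf_eq_sum_ite, ← hP.2]
    exact Finset.sum_congr rfl fun ω' _ => if_pos (Subsingleton.elim _ _)
  simp [this]

theorem entropy_subadditive {P : Ω → ℝ} (hP : P ∈ stdSimplex ℝ Ω) (f : Ω → α) (g : Ω → β) :
    entropy P (fun ω => (f ω, g ω)) ≤ entropy P f + entropy P g := by
  have := entropy_submodular hP f g fun _ => ()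
  rw [entropy_of_subsingleton hP fun _ => (),
    entropy_congr P (f := fun ω => (f ω, g ω, ())) (g := fun ω => (f ω, g ω)) (by simp),
    entropy_congr P (f := fun ω => (f ω, ())) (g := f) (by simp),
    entropy_congr P (f := fun ω => (g ω, ())) (g := g) (by simp)] at this
  linarith

open Classical in
/-- Fano's inequality. -/
theorem fano {P : Ω → ℝ} (hP : P ∈ stdSimplex ℝ Ω) (f : Ω → α) (g : Ω → β) (dec : β → α) :
    entropy P (fun ω => (f ω, g ω)) - entropy P g ≤
      1 + (∑ ω, if dec (g ω) ≠ f ω then P ω else 0) * Real.logb 2 (Fintype.card α) := by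
  have hα : ∀ _ : α, (0 : ℝ) < Fintype.card α := fun a => by
    have : Nonempty α := ⟨a⟩
    exact_mod_cast Fintype.card_pos
  -- The comparison law keeps `g`, gives half of the mass to the decoder's guess and spreads the
  -- other half uniformly. A correct guess then costs one bit, a wrong one `1 + log |α|`.
  have key := entropy_le_cross hP (fun ω => (f ω, g ω))
    (fun t => lawOf P g t.2 * (if dec t.2 = t.1 then 1 / 2 else 1 / (2 * (Fintype.card α : ℝ))))
    (fun t => mul_nonneg (lawOf_nonneg hP.1 _ _) (by split_ifs <;> positivity)) ?_ ?_
  · rw [entropy_eq_sum P g]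
    have e : ∀ ω, P ω * Real.logb 2 (lawOf P g (g ω) *
        (if dec (g ω) = f ω then 1 / 2 else 1 / (2 * (Fintype.card α : ℝ)))) =
        P ω * Real.logb 2 (lawOf P g (g ω)) - P ω -
          (if dec (g ω) ≠ f ω then P ω else 0) * Real.logb 2 (Fintype.card α) := by
      intro ω
      by_cases h0 : P ω = 0
      · simp [h0]
      have h1 := lawOf_pos hP.1 g h0
      have h2 := hα (f ω)
      have h3 : Real.logb 2 2 = 1 := Real.logb_self_eq_one one_lt_two
      by_cases hd : dec (g ω) = f ω
      · simp only [hd, if_true, ne_eq, not_true_eq_false, if_false]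
        rw [Real.logb_mul h1.ne' (by norm_num), one_div, Real.logb_inv, h3]
        ring
      · simp only [hd, if_false, ne_eq, not_false_eq_true, if_true]
        rw [Real.logb_mul h1.ne' (by positivity), one_div, Real.logb_inv,
          Real.logb_mul (by norm_num) h2.ne', h3]
        ring
    simp only [e, Finset.sum_sub_distrib, ← Finset.sum_mul, hP.2] at key
    linarith
  · rw [Fintype.sum_prod_type_right]
    calc _ ≤ ∑ b, lawOf P g b := by
          refine Finset.sum_le_sum fun b _ => ?_
          dsimp only
          rw [← Finset.mul_sum]
          refine mul_le_of_le_one_right (lawOf_nonneg hP.1 g b) ?_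
          calc _ ≤ ∑ a, ((if dec b = a then 1 / 2 else 0) + 1 / (2 * (Fintype.card α : ℝ))) := by
                refine Finset.sum_le_sum fun a _ => ?_
                have := hα a
                split_ifs
                · simp
                · simp
            _ ≤ 1 := by
                have := hα (dec b)
                rw [Finset.sum_add_distrib]
                simp only [Finset.sum_ite_eq, Finset.mem_univ, if_true, Finset.sum_const,
                  Finset.card_univ, nsmul_eq_mul]
                field_simp
                norm_num
      _ ≤ 1 := by rw [sum_lawOf, hP.2]
  · intro ω h0
    have := hα (f ω)
    refine mul_pos (lawOf_pos hP.1 g h0) ?_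
    split_ifs <;> positivity

end Entropy

end FiniteEntropy

namespace FiniteEntropy

/-! ### Independent coordinates: resampling and Chebyshev's inequality. -/

section ProductSums

variable {ι β : Type*} [Fintype ι]

/-- The mass function of independent coordinates with mass functions `q i`. -/
def piMass (q : ι → β → ℝ) (y : ι → β) : ℝ := ∏ i, q i (y i)

theorem piMass_nonneg {q : ι → β → ℝ} (hq : ∀ i b, 0 ≤ q i b) (y : ι → β) : 0 ≤ piMass q y :=
  Finset.prod_nonneg fun i _ => hq i (y i)

theorem piMass_update_mul [DecidableEq ι] (q : ι → β → ℝ) (y : ι → β) (i : ι) (b : β) :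
    piMass q (Function.update y i b) * q i (y i) = piMass q y * q i b := by
  have h (z : ι → β) : piMass q z = q i (z i) * ∏ j ∈ Finset.univ.erase i, q j (z j) :=
    (Finset.mul_prod_erase _ _ (Finset.mem_univ i)).symm
  rw [h, h y, Finset.prod_congr rfl fun j hj => by
    rw [Function.update_of_ne (Finset.ne_of_mem_erase hj)]]
  simp only [Function.update_self]
  ring

variable [Fintype β] [DecidableEq ι]

theorem sum_piMass {q : ι → β → ℝ} (hq : ∀ i, ∑ b, q i b = 1) : ∑ y, piMass q y = 1 := by
  simp only [piMass]
  rw [← Fintype.prod_sum]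
  simp [hq]

theorem piMass_mem_stdSimplex {q : ι → β → ℝ} (hq : ∀ i, q i ∈ stdSimplex ℝ β) :
    piMass q ∈ stdSimplex ℝ (ι → β) :=
  ⟨piMass_nonneg fun i => (hq i).1, sum_piMass fun i => (hq i).2⟩

/-- Drawing one of the independent coordinates afresh does not change an expectation. -/
theorem sum_piMass_resample (q : ι → β → ℝ) (i : ι) (hi : ∑ b, q i b = 1)
    (g : (ι → β) → ℝ) :
    ∑ y, piMass q y * g y = ∑ y, piMass q y * ∑ b, q i b * g (Function.update y i b) := by
  calc ∑ y, piMass q y * g y = ∑ t : (ι → β) × β, piMass q t.1 * q i t.2 * g t.1 := by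
        rw [Fintype.sum_prod_type]
        refine Finset.sum_congr rfl fun y _ => ?_
        simp only [mul_assoc, ← Finset.mul_sum]
        rw [← Finset.sum_mul, hi, one_mul]
    _ = ∑ t : (ι → β) × β, piMass q t.1 * q i t.2 * g (Function.update t.1 i t.2) := by
        -- Exchanging the old and the fresh value of coordinate `i` is an involution that preserves
        -- the weight, by `piMass_update_mul`.
        have inv : Function.Involutive
            (fun t : (ι → β) × β => (Function.update t.1 i t.2, t.1 i)) := by
          intro t
          simp
        refine Fintype.sum_equiv inv.toPerm _ _ fun t => ?_
        simp only [Function.Involutive.coe_toPerm, Function.update_idem, Function.update_eq_self]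
        rw [piMass_update_mul]
    _ = _ := by
        rw [Fintype.sum_prod_type]
        simp only [mul_assoc, Finset.mul_sum]

theorem sum_piMass_mul_apply {q : ι → β → ℝ} (hq : ∀ i, ∑ b, q i b = 1) (i : ι) (g : β → ℝ) :
    ∑ y, piMass q y * g (y i) = ∑ b, q i b * g b := by
  rw [sum_piMass_resample q i (hq i)]
  simp only [Function.update_self]
  rw [← Finset.sum_mul, sum_piMass hq, one_mul]

theorem sum_piMass_mul_apply₂ {q : ι → β → ℝ} (hq : ∀ i, ∑ b, q i b = 1) {i j : ι} (hij : i ≠ j)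
    (g : β → β → ℝ) :
    ∑ y, piMass q y * g (y i) (y j) = ∑ a, ∑ b, q i a * q j b * g a b := by
  rw [sum_piMass_resample q i (hq i)]
  simp only [Function.update_self, Function.update_of_ne hij.symm]
  rw [sum_piMass_mul_apply hq j fun b => ∑ a, q i a * g a b]
  simp only [Finset.mul_sum]
  rw [Finset.sum_comm]
  exact Finset.sum_congr rfl fun a _ => Finset.sum_congr rfl fun b _ => by ring

open Classical in
/-- Chebyshev's inequality for the lower tail of a sum of independent identically distributed
variables. -/
theorem chebyshev_lower_tail {P : β → ℝ} (hP : P ∈ stdSimplex ℝ β) (f : β → ℝ) {δ : ℝ}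
    (hδ : 0 < δ) {n : ℕ} (hn : 0 < n) :
    ∑ y : Fin n → β, piMass (fun _ => P) y *
        (if ∑ i, f (y i) ≤ n * ((∑ b, P b * f b) - δ) then 1 else 0) ≤
      (∑ b, P b * (f b - ∑ b, P b * f b) ^ 2) / (n * δ ^ 2) := by
  set μ := ∑ b, P b * f b with hμ
  have hn' : (0 : ℝ) < n := by exact_mod_cast hn
  have hmean : ∑ b, P b * (f b - μ) = 0 := by
    simp only [mul_sub, Finset.sum_sub_distrib, ← Finset.sum_mul, hP.2, ← hμ]
    ring
  have hvar : ∑ y : Fin n → β, piMass (fun _ => P) y * (∑ i, (f (y i) - μ)) ^ 2 =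
      n * ∑ b, P b * (f b - μ) ^ 2 := by
    have expand (y : Fin n → β) : piMass (fun _ => P) y * (∑ i, (f (y i) - μ)) ^ 2 =
        ∑ i, ∑ j, piMass (fun _ => P) y * ((f (y i) - μ) * (f (y j) - μ)) := by
      rw [pow_two, Finset.sum_mul_sum]
      simp only [Finset.mul_sum]
    simp only [expand]
    rw [Finset.sum_comm]
    have : ∀ i : Fin n, ∑ y : Fin n → β, ∑ j, piMass (fun _ => P) y *
        ((f (y i) - μ) * (f (y j) - μ)) = ∑ b, P b * (f b - μ) ^ 2 := by
      intro i
      rw [Finset.sum_comm, Finset.sum_eq_single i]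
      · rw [← sum_piMass_mul_apply (q := fun _ : Fin n => P) (fun _ => hP.2) i]
        exact Finset.sum_congr rfl fun _ _ => by ring
      · intro j _ hj
        rw [sum_piMass_mul_apply₂ (q := fun _ : Fin n => P) (fun _ => hP.2) hj.symm
          fun a b => (f a - μ) * (f b - μ)]
        have : ∀ a, ∑ b, P a * P b * ((f a - μ) * (f b - μ)) =
            P a * (f a - μ) * ∑ b, P b * (f b - μ) := by
          intro a
          rw [Finset.mul_sum]
          exact Finset.sum_congr rfl fun _ _ => by ring
        simp [this, hmean]
      · simp
    simp only [this, Finset.sum_const, Finset.card_univ, Fintype.card_fin, nsmul_eq_mul,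
      Finset.mul_sum]
  calc _ ≤ ∑ y : Fin n → β, piMass (fun _ => P) y *
          ((∑ i, (f (y i) - μ)) ^ 2 / (n * δ) ^ 2) := by
        refine Finset.sum_le_sum fun y _ => mul_le_mul_of_nonneg_left ?_
          (piMass_nonneg (fun _ => hP.1) y)
        split_ifs with h
        · rw [one_le_div (by positivity)]
          have : n * δ ≤ -∑ i, (f (y i) - μ) := by
            simp only [Finset.sum_sub_distrib, Finset.sum_const, Finset.card_univ,
              Fintype.card_fin, nsmul_eq_mul]
            linarith
          rw [← neg_sq (∑ i, (f (y i) - μ))]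
          gcongr
        · positivity
    _ = (n * ∑ b, P b * (f b - μ) ^ 2) / (n * δ) ^ 2 := by
        rw [← hvar, Finset.sum_div]
        exact Finset.sum_congr rfl fun _ _ => by ring
    _ = _ := by
        field_simp

end ProductSums

end FiniteEntropy

namespace FiniteEntropy

/-! ### Random superposition codebooks and one-shot coding. -/

section Decoding

open Classical in
/-- The decoder that outputs the unique index passing the test, if there is one. -/
noncomputable def uniqueDecoder {C Z : Type*} [Nonempty C] (T : C → Z → Prop) (z : Z) : C :=
  if h : ∃ c, T c z ∧ ∀ c', T c' z → c' = c then h.choose else Classical.arbitrary C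

theorem uniqueDecoder_eq {C Z : Type*} [Nonempty C] {T : C → Z → Prop} {z : Z} {c : C}
    (hc : T c z) (h : ∀ c', T c' z → c' = c) : uniqueDecoder T z = c := by
  have hex : ∃ c, T c z ∧ ∀ c', T c' z → c' = c := ⟨c, hc, h⟩
  rw [uniqueDecoder, dif_pos hex]
  exact h _ hex.choose_spec.1

end Decoding

section Superposition

variable {𝒰 𝒳 𝒴 C M : Type*} [Fintype 𝒰] [Fintype 𝒳] [Fintype 𝒴] [Fintype C] [Fintype M]
  [DecidableEq C] [DecidableEq M]

/-- Expectation over a random superposition codebook: the cloud centers are independent with mass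
function `PU`, and the codeword of the message `m` is drawn from `Q (u (π m))`. -/
def codebookMean (PU : 𝒰 → ℝ) (Q : 𝒰 → 𝒳 → ℝ) (π : M → C) (g : (C → 𝒰) → (M → 𝒳) → ℝ) : ℝ :=
  ∑ u, piMass (fun _ => PU) u * ∑ x, piMass (fun m => Q (u (π m))) x * g u x

variable {PU : 𝒰 → ℝ} {Q : 𝒰 → 𝒳 → ℝ} {π : M → C}

theorem codebookMean_mono (hPU : PU ∈ stdSimplex ℝ 𝒰) (hQ : ∀ u, Q u ∈ stdSimplex ℝ 𝒳)
    {g g' : (C → 𝒰) → (M → 𝒳) → ℝ} (h : ∀ u x, g u x ≤ g' u x) :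
    codebookMean PU Q π g ≤ codebookMean PU Q π g' :=
  Finset.sum_le_sum fun u _ => mul_le_mul_of_nonneg_left
    (Finset.sum_le_sum fun x _ => mul_le_mul_of_nonneg_left (h u x)
      (piMass_nonneg (fun m => (hQ (u (π m))).1) x)) (piMass_nonneg (fun _ => hPU.1) u)

theorem codebookMean_add (g g' : (C → 𝒰) → (M → 𝒳) → ℝ) :
    codebookMean PU Q π (fun u x => g u x + g' u x) =
      codebookMean PU Q π g + codebookMean PU Q π g' := by
  simp only [codebookMean, mul_add, Finset.sum_add_distrib]

theorem codebookMean_sum {ι : Type*} (s : Finset ι) (g : ι → (C → 𝒰) → (M → 𝒳) → ℝ) :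
    codebookMean PU Q π (fun u x => ∑ i ∈ s, g i u x) = ∑ i ∈ s, codebookMean PU Q π (g i) := by
  classical
  induction s using Finset.induction_on with
  | empty => simp [codebookMean]
  | insert i s hi ih =>
    simp only [Finset.sum_insert hi]
    rw [codebookMean_add, ih]

theorem codebookMean_const (hPU : PU ∈ stdSimplex ℝ 𝒰) (hQ : ∀ u, Q u ∈ stdSimplex ℝ 𝒳) (a : ℝ) :
    codebookMean PU Q π (fun _ _ => a) = a := by
  simp only [codebookMean, ← Finset.sum_mul]
  simp only [sum_piMass fun m => (hQ _).2, one_mul]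
  rw [← Finset.sum_mul, sum_piMass fun _ : C => hPU.2, one_mul]

theorem exists_le_of_codebookMean_le (hPU : PU ∈ stdSimplex ℝ 𝒰)
    (hQ : ∀ u, Q u ∈ stdSimplex ℝ 𝒳) {g : (C → 𝒰) → (M → 𝒳) → ℝ} {b : ℝ}
    (h : codebookMean PU Q π g ≤ b) : ∃ u x, g u x ≤ b := by
  have n1 : Nonempty 𝒰 := by
    by_contra hne
    rw [not_nonempty_iff] at hne
    simpa using hPU.2
  have n2 : Nonempty 𝒳 := by
    by_contra hne
    rw [not_nonempty_iff] at hne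
    simpa using (hQ (Classical.arbitrary 𝒰)).2
  obtain ⟨t, ht⟩ := Finite.exists_min fun t : (C → 𝒰) × (M → 𝒳) => g t.1 t.2
  refine ⟨t.1, t.2, ?_⟩
  rw [← codebookMean_const (π := π) hPU hQ (g t.1 t.2)]
  exact (codebookMean_mono hPU hQ fun u x => ht (u, x)).trans h

theorem codebookMean_apply (hPU : PU ∈ stdSimplex ℝ 𝒰) (hQ : ∀ u, Q u ∈ stdSimplex ℝ 𝒳)
    (m : M) (g : 𝒰 → 𝒳 → ℝ) :
    codebookMean PU Q π (fun u x => g (u (π m)) (x m)) = ∑ u, PU u * ∑ x, Q u x * g u x := by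
  rw [codebookMean, ← sum_piMass_mul_apply (fun _ : C => hPU.2) (π m)
    fun u => ∑ x, Q u x * g u x]
  refine Finset.sum_congr rfl fun u _ => ?_
  rw [sum_piMass_mul_apply (fun m => (hQ (u (π m))).2) m]

/-- A cloud center is independent of the codewords of the other clouds. -/
theorem codebookMean_cloud_le (hPU : PU ∈ stdSimplex ℝ 𝒰) (hQ : ∀ u, Q u ∈ stdSimplex ℝ 𝒳)
    {m : M} {c : C} (hc : c ≠ π m) {φ : 𝒳 → ℝ} (hφ : ∀ x, 0 ≤ φ x) {t : 𝒰 → ℝ} {e : ℝ}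
    (ht : ∑ u, PU u * t u ≤ e) :
    codebookMean PU Q π (fun u x => φ (x m) * t (u c)) ≤
      e * codebookMean PU Q π (fun _ x => φ (x m)) := by
  have h1 : codebookMean PU Q π (fun u x => φ (x m) * t (u c)) =
      ∑ u, piMass (fun _ => PU) u * (t (u c) * ∑ x, Q (u (π m)) x * φ x) := by
    refine Finset.sum_congr rfl fun u _ => ?_
    rw [← sum_piMass_mul_apply (fun m => (hQ (u (π m))).2) m]
    congr 1
    rw [Finset.mul_sum]
    exact Finset.sum_congr rfl fun _ _ => by ring
  rw [h1, codebookMean_apply hPU hQ m fun _ x => φ x,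
    sum_piMass_mul_apply₂ (fun _ : C => hPU.2) hc fun a b => t a * ∑ x, Q b x * φ x]
  have h2 : ∑ a, ∑ b, PU a * PU b * (t a * ∑ x, Q b x * φ x) =
      (∑ a, PU a * t a) * ∑ b, PU b * ∑ x, Q b x * φ x := by
    rw [Finset.sum_mul_sum]
    exact Finset.sum_congr rfl fun _ _ => Finset.sum_congr rfl fun _ _ => by ring
  rw [h2]
  exact mul_le_mul_of_nonneg_right ht (Finset.sum_nonneg fun b _ => mul_nonneg (hPU.1 b)
    (Finset.sum_nonneg fun x _ => mul_nonneg ((hQ b).1 x) (hφ x)))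

/-- A codeword of another cloud is independent of the given codeword. -/
theorem codebookMean_other_cloud_le (hPU : PU ∈ stdSimplex ℝ 𝒰) (hQ : ∀ u, Q u ∈ stdSimplex ℝ 𝒳)
    {m m' : M} (hm : π m' ≠ π m) {φ : 𝒳 → ℝ} (hφ : ∀ x, 0 ≤ φ x) {t : 𝒰 → 𝒳 → ℝ} {e : ℝ}
    (ht : ∑ u, PU u * ∑ x, Q u x * t u x ≤ e) :
    codebookMean PU Q π (fun u x => φ (x m) * t (u (π m')) (x m')) ≤
      e * codebookMean PU Q π (fun _ x => φ (x m)) := by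
  have h1 : codebookMean PU Q π (fun u x => φ (x m) * t (u (π m')) (x m')) =
      codebookMean PU Q π (fun u x => φ (x m) * ∑ b, Q (u (π m')) b * t (u (π m')) b) := by
    refine Finset.sum_congr rfl fun u _ => ?_
    rw [sum_piMass_resample _ m' (hQ (u (π m'))).2]
    simp only [Function.update_self,
      Function.update_of_ne (fun h => hm (congrArg π h).symm : m ≠ m')]
    congr 1
    refine Finset.sum_congr rfl fun x _ => ?_
    simp only [Finset.mul_sum]
    exact Finset.sum_congr rfl fun _ _ => by ring
  rw [h1]
  exact codebookMean_cloud_le hPU hQ hm hφ ht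

/-- Given the cloud center, two codewords of the same cloud are independent. -/
theorem codebookMean_same_cloud_le (hPU : PU ∈ stdSimplex ℝ 𝒰) (hQ : ∀ u, Q u ∈ stdSimplex ℝ 𝒳)
    {m m' : M} (hm : m' ≠ m) {φ : 𝒳 → ℝ} (hφ : ∀ x, 0 ≤ φ x) {t : 𝒰 → 𝒳 → ℝ}
    {e : ℝ} (ht : ∀ u, ∑ x, Q u x * t u x ≤ e) :
    codebookMean PU Q π (fun u x => φ (x m) * t (u (π m')) (x m')) ≤
      e * codebookMean PU Q π (fun _ x => φ (x m)) := by
  simp only [codebookMean]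
  rw [Finset.mul_sum]
  refine Finset.sum_le_sum fun u _ => ?_
  rw [mul_left_comm]
  refine mul_le_mul_of_nonneg_left ?_ (piMass_nonneg (fun _ => hPU.1) u)
  rw [sum_piMass_resample _ m' (hQ (u (π m'))).2, Finset.mul_sum]
  simp only [Function.update_self, Function.update_of_ne hm.symm]
  refine Finset.sum_le_sum fun x _ => ?_
  rw [mul_left_comm]
  refine mul_le_mul_of_nonneg_left ?_ (piMass_nonneg (fun m => (hQ (u (π m))).1) x)
  calc _ = φ (x m) * ∑ b, Q (u (π m')) b * t (u (π m')) b := by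
        rw [Finset.mul_sum]
        exact Finset.sum_congr rfl fun _ _ => by ring
    _ ≤ φ (x m) * e := mul_le_mul_of_nonneg_left (ht _) (hφ _)
    _ = _ := mul_comm _ _

open Classical in
/-- One-shot superposition coding: receiver 2 decodes the cloud, receiver 1 the codeword, both by
looking for the only candidate that passes a test. -/
theorem exists_superposition_code [Nonempty M] {Z₁ Z₂ : Type*}
    (hPU : PU ∈ stdSimplex ℝ 𝒰) (hQ : ∀ u, Q u ∈ stdSimplex ℝ 𝒳)
    {V : 𝒳 → 𝒴 → ℝ} (hV : ∀ x, V x ∈ stdSimplex ℝ 𝒴) (f₁ : 𝒴 → Z₁) (f₂ : 𝒴 → Z₂)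
    (T₁ : 𝒰 → 𝒳 → Z₁ → Prop) (T₂ : 𝒰 → Z₂ → Prop) (π : M → C) {e₀ e₁ e₂ : ℝ}
    (he₀ : 0 ≤ e₀) (he₁ : 0 ≤ e₁)
    (h₂ : ∀ z, ∑ u, PU u * (if T₂ u z then 1 else 0) ≤ e₂)
    (h₁ : ∀ u z, ∑ x, Q u x * (if T₁ u x z then 1 else 0) ≤ e₁)
    (h₀ : ∀ z, ∑ u, PU u * ∑ x, Q u x * (if T₁ u x z then 1 else 0) ≤ e₀)
    {N : ℕ} (hN : ∀ m, (Finset.univ.filter fun m' => π m' = π m).card ≤ N) :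
    ∃ (x : M → 𝒳) (d₁ : Z₁ → M) (d₂ : Z₂ → C),
      ∑ m, ∑ y, (if d₁ (f₁ y) ≠ m ∨ d₂ (f₂ y) ≠ π m then V (x m) y else 0) ≤
        Fintype.card M * ((∑ u, PU u * ∑ x, Q u x * ∑ y, V x y *
            ((if T₂ u (f₂ y) then 0 else 1) + (if T₁ u x (f₁ y) then 0 else 1))) +
          ((Fintype.card C : ℝ) - 1) * e₂ + ((N : ℝ) - 1) * e₁ +
          ((Fintype.card M : ℝ) - 1) * e₀) := by
  have : Nonempty C := ⟨π (Classical.arbitrary M)⟩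
  set miss := ∑ u, PU u * ∑ x, Q u x * ∑ y, V x y *
    ((if T₂ u (f₂ y) then (0 : ℝ) else 1) + (if T₁ u x (f₁ y) then 0 else 1)) with hmiss
  let D₁ (u : C → 𝒰) (x : M → 𝒳) : Z₁ → M := uniqueDecoder fun m z => T₁ (u (π m)) (x m) z
  let D₂ (u : C → 𝒰) : Z₂ → C := uniqueDecoder fun c z => T₂ (u c) z
  let err (u : C → 𝒰) (x : M → 𝒳) (m : M) (y : 𝒴) : ℝ :=
    if D₁ u x (f₁ y) ≠ m ∨ D₂ u (f₂ y) ≠ π m then V (x m) y else 0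
  -- The union bound, in this order: the truth fails a test; a wrong cloud passes at receiver 2; a
  -- wrong codeword of the true cloud passes at receiver 1; a codeword of another cloud passes
  -- there.
  let bound (u : C → 𝒰) (x : M → 𝒳) (m : M) (y : 𝒴) : ℝ :=
    V (x m) y * ((if T₂ (u (π m)) (f₂ y) then 0 else 1) +
      (if T₁ (u (π m)) (x m) (f₁ y) then 0 else 1)) +
    (∑ c ∈ Finset.univ.erase (π m), V (x m) y * (if T₂ (u c) (f₂ y) then 1 else 0)) +
    (∑ m' ∈ (Finset.univ.filter fun m' => π m' = π m).erase m,
      V (x m) y * (if T₁ (u (π m')) (x m') (f₁ y) then 1 else 0)) +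
    (∑ m' ∈ Finset.univ.filter fun m' => π m' ≠ π m,
      V (x m) y * (if T₁ (u (π m')) (x m') (f₁ y) then 1 else 0))
  have err_le : ∀ u x m y, err u x m y ≤ bound u x m y := by
    intro u x m y
    have n0 : 0 ≤ V (x m) y := (hV _).1 y
    have i0 (p : Prop) [Decidable p] : 0 ≤ V (x m) y * (if p then 1 else 0) :=
      mul_nonneg n0 (by split_ifs <;> norm_num)
    have a1 : 0 ≤ V (x m) y * ((if T₂ (u (π m)) (f₂ y) then 0 else 1) +
        (if T₁ (u (π m)) (x m) (f₁ y) then 0 else 1)) :=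
      mul_nonneg n0 (add_nonneg (by split_ifs <;> norm_num) (by split_ifs <;> norm_num))
    have a2 : 0 ≤ ∑ c ∈ Finset.univ.erase (π m), V (x m) y * (if T₂ (u c) (f₂ y) then 1 else 0) :=
      Finset.sum_nonneg fun _ _ => i0 _
    have a3 : 0 ≤ ∑ m' ∈ (Finset.univ.filter fun m' => π m' = π m).erase m,
        V (x m) y * (if T₁ (u (π m')) (x m') (f₁ y) then 1 else 0) :=
      Finset.sum_nonneg fun _ _ => i0 _
    have a4 : 0 ≤ ∑ m' ∈ Finset.univ.filter fun m' => π m' ≠ π m,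
        V (x m) y * (if T₁ (u (π m')) (x m') (f₁ y) then 1 else 0) :=
      Finset.sum_nonneg fun _ _ => i0 _
    simp only [err, bound]
    by_cases he : D₁ u x (f₁ y) ≠ m ∨ D₂ u (f₂ y) ≠ π m
    swap
    · rw [if_neg he]
      linarith
    rw [if_pos he]
    by_cases b1 : T₂ (u (π m)) (f₂ y) ∧ T₁ (u (π m)) (x m) (f₁ y)
    · rcases he with he | he
      · obtain ⟨m', hm', hne⟩ : ∃ m', T₁ (u (π m')) (x m') (f₁ y) ∧ m' ≠ m := by
          by_contra! hcon
          exact he (uniqueDecoder_eq (T := fun m z => T₁ (u (π m)) (x m) z) b1.2 hcon)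
        by_cases hπ : π m' = π m
        · have := Finset.single_le_sum (f := fun m' => V (x m) y *
            (if T₁ (u (π m')) (x m') (f₁ y) then (1 : ℝ) else 0)) (fun _ _ => i0 _)
            (show m' ∈ (Finset.univ.filter fun m' => π m' = π m).erase m by simp [hne, hπ])
          simp only [hm', if_true, mul_one] at this
          linarith
        · have := Finset.single_le_sum (f := fun m' => V (x m) y *
            (if T₁ (u (π m')) (x m') (f₁ y) then (1 : ℝ) else 0)) (fun _ _ => i0 _)
            (show m' ∈ Finset.univ.filter fun m' => π m' ≠ π m by simp [hπ])
          simp only [hm', if_true, mul_one] at this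
          linarith
      · obtain ⟨c, hc, hne⟩ : ∃ c, T₂ (u c) (f₂ y) ∧ c ≠ π m := by
          by_contra! hcon
          exact he (uniqueDecoder_eq (T := fun c z => T₂ (u c) z) b1.1 hcon)
        have := Finset.single_le_sum (f := fun c => V (x m) y *
            (if T₂ (u c) (f₂ y) then (1 : ℝ) else 0)) (fun _ _ => i0 _)
            (show c ∈ Finset.univ.erase (π m) by simp [hne])
        simp only [hc, if_true, mul_one] at this
        linarith
    · have : V (x m) y ≤ V (x m) y * ((if T₂ (u (π m)) (f₂ y) then 0 else 1) +
          (if T₁ (u (π m)) (x m) (f₁ y) then 0 else 1)) := by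
        refine le_mul_of_one_le_right n0 ?_
        rcases not_and_or.1 b1 with b | b
        · simp only [b, if_false]
          split_ifs <;> norm_num
        · simp only [b, if_false]
          split_ifs <;> norm_num
      linarith
  have hone : ∀ m : M, ∑ y, codebookMean PU Q π (fun _ x => V (x m) y) = 1 := by
    intro m
    rw [← codebookMean_sum]
    simp only [(hV _).2]
    exact codebookMean_const hPU hQ 1
  -- The independence bounds hold separately for each output `y`; since the output weights add up to
  -- one, so does their sum over `y`.
  have sum_le {m : M} {F : 𝒴 → ℝ} {e : ℝ}
      (h : ∀ y, F y ≤ e * codebookMean PU Q π (fun _ x => V (x m) y)) : ∑ y, F y ≤ e := by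
    refine (Finset.sum_le_sum fun y _ => h y).trans_eq ?_
    rw [← Finset.mul_sum, hone, mul_one]
  have card_C : 1 ≤ Fintype.card C := Fintype.card_pos
  have card_M : 1 ≤ Fintype.card M := Fintype.card_pos
  have mean_le : ∀ m, codebookMean PU Q π (fun u x => ∑ y, bound u x m y) ≤
      miss + ((Fintype.card C : ℝ) - 1) * e₂ + ((N : ℝ) - 1) * e₁ +
          ((Fintype.card M : ℝ) - 1) * e₀ := by
    intro m
    simp only [bound, Finset.sum_add_distrib, codebookMean_add]
    refine add_le_add (add_le_add (add_le_add ?_ ?_) ?_) ?_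
    · rw [hmiss]
      exact (codebookMean_apply hPU hQ m fun u x => ∑ y, V x y *
        ((if T₂ u (f₂ y) then (0 : ℝ) else 1) + (if T₁ u x (f₁ y) then 0 else 1))).le
    · have : ∀ c ∈ Finset.univ.erase (π m), ∑ y, codebookMean PU Q π (fun u x => V (x m) y *
          (if T₂ (u c) (f₂ y) then 1 else 0)) ≤ e₂ := fun c hc => sum_le fun y =>
        codebookMean_cloud_le hPU hQ (Finset.ne_of_mem_erase hc) (fun x => (hV x).1 y)
          (t := fun u => if T₂ u (f₂ y) then 1 else 0) (h₂ _)
      simp only [codebookMean_sum]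
      rw [Finset.sum_comm]
      refine (Finset.sum_le_sum this).trans_eq ?_
      rw [Finset.sum_const, Finset.card_erase_of_mem (Finset.mem_univ _), Finset.card_univ,
        nsmul_eq_mul, Nat.cast_sub card_C, Nat.cast_one]
    · have : ∀ m' ∈ (Finset.univ.filter fun m' => π m' = π m).erase m,
          ∑ y, codebookMean PU Q π (fun u x => V (x m) y *
          (if T₁ (u (π m')) (x m') (f₁ y) then 1 else 0)) ≤ e₁ := fun m' hm' => sum_le fun y =>
        codebookMean_same_cloud_le hPU hQ (Finset.ne_of_mem_erase hm') (fun x => (hV x).1 y)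
          (t := fun u x => if T₁ u x (f₁ y) then 1 else 0) fun u => h₁ u _
      simp only [codebookMean_sum]
      rw [Finset.sum_comm]
      refine (Finset.sum_le_sum this).trans ?_
      have hmem : m ∈ Finset.univ.filter fun m' => π m' = π m := by simp
      have hN' := Finset.card_pos.2 ⟨m, hmem⟩
      rw [Finset.sum_const, Finset.card_erase_of_mem hmem, nsmul_eq_mul, Nat.cast_sub hN',
        Nat.cast_one]
      have : (((Finset.univ.filter fun m' => π m' = π m).card : ℕ) : ℝ) ≤ N := by
        exact_mod_cast hN m
      gcongr
    · have : ∀ m' ∈ Finset.univ.filter fun m' => π m' ≠ π m,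
          ∑ y, codebookMean PU Q π (fun u x => V (x m) y *
          (if T₁ (u (π m')) (x m') (f₁ y) then 1 else 0)) ≤ e₀ := fun m' hm' => sum_le fun y =>
        codebookMean_other_cloud_le hPU hQ (Finset.mem_filter.1 hm').2 (fun x => (hV x).1 y)
          (t := fun u x => if T₁ u x (f₁ y) then 1 else 0) (h₀ _)
      simp only [codebookMean_sum]
      rw [Finset.sum_comm]
      refine (Finset.sum_le_sum this).trans ?_
      rw [Finset.sum_const, nsmul_eq_mul]
      refine mul_le_mul_of_nonneg_right ?_ he₀
      rw [← Nat.cast_one, ← Nat.cast_sub card_M, ← Finset.card_univ,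
        ← Finset.card_erase_of_mem (Finset.mem_univ m)]
      refine Nat.cast_le.2 (Finset.card_le_card fun m' hm' => ?_)
      simp only [Finset.mem_erase, Finset.mem_univ, and_true]
      rintro rfl
      simp at hm'
  set B := miss + ((Fintype.card C : ℝ) - 1) * e₂ + ((N : ℝ) - 1) * e₁ +
          ((Fintype.card M : ℝ) - 1) * e₀
  have total : codebookMean PU Q π (fun u x => ∑ m, ∑ y, err u x m y) ≤ Fintype.card M * B := by
    rw [codebookMean_sum]
    refine (Finset.sum_le_sum fun m _ => (codebookMean_mono hPU hQ fun u x =>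
      Finset.sum_le_sum fun y _ => err_le u x m y).trans (mean_le m)).trans_eq ?_
    rw [Finset.sum_const, nsmul_eq_mul, Finset.card_univ]
  -- Derandomization: some codebook is no worse than the average.
  obtain ⟨u, x, hux⟩ := exists_le_of_codebookMean_le hPU hQ total
  exact ⟨x, D₁ u x, D₂ u, hux⟩

end Superposition

end FiniteEntropy

namespace FiniteEntropy

/-! ### Threshold tests on likelihood ratios. -/

section Density

variable {α β γ Ω : Type*} [Fintype α] [Fintype β] [Fintype γ] [Fintype Ω]

open Classical in
/-- A change of measure bound for a threshold test between `J` and the product of `μ` and `ν`. -/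
theorem sum_threshold_le {α β : Type*} [Fintype α] {J : α → β → ℝ} {μ : α → ℝ} {ν : β → ℝ} (hJ : ∀ a b, 0 ≤ J a b)
    (hν : ∀ b, ∑ a, J a b = ν b) {τ : ℝ} (hτ : 0 < τ) {T : α → β → Prop}
    (hT : ∀ a b, T a b → τ * (μ a * ν b) < J a b) (b : β) :
    ∑ a, μ a * (if T a b then 1 else 0) ≤ 1 / τ := by
  have hν0 : 0 ≤ ν b := hν b ▸ Finset.sum_nonneg fun a _ => hJ a b
  rcases hν0.eq_or_lt with h0 | h0
  · have hz : ∀ a, J a b = 0 := fun a =>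
      (Finset.sum_eq_zero_iff_of_nonneg fun a _ => hJ a b).1 ((hν b).trans h0.symm) a
        (Finset.mem_univ a)
    -- Because the inequality in `hT` is strict, no test passes at an output of mass zero.
    have hT' : ∀ a, ¬T a b := fun a h => by simpa [hz, ← h0] using hT a b h
    simp only [hT', if_false, mul_zero, Finset.sum_const_zero]
    positivity
  · calc _ ≤ ∑ a, J a b / (τ * ν b) := by
          refine Finset.sum_le_sum fun a _ => ?_
          split_ifs with h
          · have := hT a b h
            rw [le_div_iff₀ (by positivity)]
            linarith
          · rw [mul_zero]
            exact div_nonneg (hJ a b) (by positivity)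
      _ = 1 / τ := by
          rw [← Finset.sum_div, hν]
          field_simp

-- Products of joint masses have products of marginals, so the one-shot bound applies to blocks. The
-- factors may vary with `i`, as they do once a cloud center is fixed.
open Classical in
theorem sum_piMass_threshold_le {ι α β : Type*} [Fintype ι] [DecidableEq ι] [Fintype α]
    {J : ι → α → β → ℝ} {μ : ι → α → ℝ} {ν : ι → β → ℝ} (hJ : ∀ i a b, 0 ≤ J i a b)
    (hν : ∀ i b, ∑ a, J i a b = ν i b) {τ : ℝ} (hτ : 0 < τ) {T : (ι → α) → (ι → β) → Prop}
    (hT : ∀ x y, T x y →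
      τ * ((∏ i, μ i (x i)) * ∏ i, ν i (y i)) < ∏ i, J i (x i) (y i)) (y : ι → β) :
    ∑ x, piMass μ x * (if T x y then 1 else 0) ≤ 1 / τ :=
  sum_threshold_le (J := fun x y => ∏ i, J i (x i) (y i)) (ν := fun y => ∏ i, ν i (y i))
    (fun _ _ => Finset.prod_nonneg fun i _ => hJ i _ _)
    (fun y => by
      rw [← Fintype.prod_sum fun i a => J i a (y i)]
      exact Finset.prod_congr rfl fun i _ => hν i _) hτ hT y

open Classical in
/-- The law of large numbers for a threshold test: the true product law passes it. -/
theorem sum_threshold_fail_le {P : Ω → ℝ} (hP : P ∈ stdSimplex ℝ Ω) {a b : Ω → ℝ}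
    (ha : ∀ ω, P ω ≠ 0 → 0 < a ω) (hb : ∀ ω, P ω ≠ 0 → 0 < b ω) {I δ : ℝ} (hδ : 0 < δ)
    (hI : I = ∑ ω, P ω * (Real.logb 2 (a ω) - Real.logb 2 (b ω))) {n : ℕ} (hn : 0 < n)
    {T : (Fin n → Ω) → Prop}
    (hT : ∀ y, (2 : ℝ) ^ (n * (I - δ)) * ∏ i, b (y i) < ∏ i, a (y i) → T y) :
    ∑ y : Fin n → Ω, piMass (fun _ => P) y * (if T y then 0 else 1) ≤
      (∑ ω, P ω * ((Real.logb 2 (a ω) - Real.logb 2 (b ω)) - I) ^ 2) / (n * δ ^ 2) := by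
  refine le_trans ?_ (hI ▸ chebyshev_lower_tail hP
    (fun ω => Real.logb 2 (a ω) - Real.logb 2 (b ω)) hδ hn)
  refine Finset.sum_le_sum fun y _ => ?_
  by_cases h0 : piMass (fun _ => P) y = 0
  · simp [h0]
  refine mul_le_mul_of_nonneg_left ?_ (piMass_nonneg (fun _ => hP.1) y)
  have hy : ∀ i, P (y i) ≠ 0 := fun i => by
    rw [piMass, ← ne_eq, Finset.prod_ne_zero_iff] at h0
    exact h0 i (Finset.mem_univ i)
  have ha' : 0 < ∏ i, a (y i) := Finset.prod_pos fun i _ => ha _ (hy i)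
  have hb' : 0 < ∏ i, b (y i) := Finset.prod_pos fun i _ => hb _ (hy i)
  split_ifs with h1 h2 h2
  · exact zero_le_one
  · exact le_rfl
  · exact le_rfl
  · refine absurd (lt_of_not_ge h2) fun h3 => h1 (hT y ?_)
    rw [Finset.sum_sub_distrib, ← Real.logb_prod _ _ fun i _ => (ha _ (hy i)).ne',
      ← Real.logb_prod _ _ fun i _ => (hb _ (hy i)).ne', ← Real.logb_div ha'.ne' hb'.ne',
      Real.lt_logb_iff_rpow_lt one_lt_two (div_pos ha' hb'), lt_div_iff₀ hb'] at h3
    exact h3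

/-- Writing the information as the mean of a log-likelihood ratio is what brings it within reach of
the law of large numbers. -/
theorem mutualInfo_eq_sum {P : Ω → ℝ} (hP : ∀ ω, 0 ≤ P ω) (f : Ω → α) (g : Ω → β) :
    mutualInfo P f g = ∑ ω, P ω * (Real.logb 2 (lawOf P (fun ω => (f ω, g ω)) (f ω, g ω)) -
      Real.logb 2 (lawOf P f (f ω) * lawOf P g (g ω))) := by
  rw [mutualInfo, entropy_eq_sum, entropy_eq_sum, entropy_eq_sum, sub_neg_eq_add, ← neg_add,
    ← Finset.sum_add_distrib, neg_add_eq_sub, ← Finset.sum_sub_distrib]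
  refine Finset.sum_congr rfl fun ω _ => ?_
  by_cases h0 : P ω = 0
  · simp [h0]
  rw [Real.logb_mul (lawOf_pos hP f h0).ne' (lawOf_pos hP g h0).ne']
  ring

/-- Any version `Q` of the conditional law of `f` given `h` serves, since only points of nonzero
mass contribute. -/
theorem condMutualInfo_eq_sum {P : Ω → ℝ} (hP : ∀ ω, 0 ≤ P ω) (f : Ω → α) (g : Ω → β)
    (h : Ω → γ) {Q : γ → α → ℝ}
    (hQ : ∀ c a, lawOf P h c * Q c a = lawOf P (fun ω => (f ω, h ω)) (a, c)) :
    condMutualInfo P f g h =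
      ∑ ω, P ω * (Real.logb 2 (lawOf P (fun ω => (f ω, g ω, h ω)) (f ω, g ω, h ω)) -
        Real.logb 2 (Q (h ω) (f ω) * lawOf P (fun ω => (g ω, h ω)) (g ω, h ω))) := by
  rw [condMutualInfo, entropy_eq_sum, entropy_eq_sum, entropy_eq_sum, entropy_eq_sum,
    sub_neg_eq_add, sub_neg_eq_add, ← neg_add, ← Finset.sum_add_distrib, neg_add_eq_sub,
    ← Finset.sum_sub_distrib, ← Finset.sum_add_distrib]
  refine Finset.sum_congr rfl fun ω _ => ?_
  by_cases h0 : P ω = 0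
  · simp [h0]
  have h1 := lawOf_pos hP (fun ω => (f ω, h ω)) h0
  have h2 := lawOf_pos hP h h0
  have h3 := hQ (h ω) (f ω)
  have h4 : Q (h ω) (f ω) ≠ 0 := fun h => by
    rw [h, mul_zero] at h3
    exact h1.ne h3
  rw [← h3, Real.logb_mul h4 (lawOf_pos hP (fun ω => (g ω, h ω)) h0).ne',
    Real.logb_mul h2.ne' h4]
  ring

end Density

section Disintegration

variable {A X : Type*} [Fintype A] [Fintype X]

/-- The conditional mass function of the second coordinate given the first. -/
noncomputable def condKernel (p : A × X → ℝ) (a : A) (x : X) : ℝ :=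
  -- On null values of `a` any mass function would do; one is needed because codewords are drawn
  -- from `condKernel p a` for every `a`.
  if lawOf p Prod.fst a = 0 then lawOf p Prod.snd x else p (a, x) / lawOf p Prod.fst a

theorem condKernel_mem_stdSimplex {p : A × X → ℝ} (hp : p ∈ stdSimplex ℝ (A × X)) (a : A) :
    condKernel p a ∈ stdSimplex ℝ X := by
  unfold condKernel
  by_cases h : lawOf p Prod.fst a = 0
  · simp only [h, if_true]
    exact lawOf_mem_stdSimplex hp _
  · simp only [h, if_false]
    refine ⟨fun x => div_nonneg (hp.1 _) (lawOf_nonneg hp.1 _ _), ?_⟩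
    rw [← Finset.sum_div, ← lawOf_fst, div_self h]

theorem lawOf_fst_mul_condKernel {p : A × X → ℝ} (hp : ∀ t, 0 ≤ p t) (a : A) (x : X) :
    lawOf p Prod.fst a * condKernel p a x = p (a, x) := by
  unfold condKernel
  split_ifs with h
  · rw [h, zero_mul]
    refine le_antisymm (hp _) ?_
    rw [← h]
    exact le_lawOf hp Prod.fst (a, x)
  · exact mul_div_cancel₀ _ h

end Disintegration

end FiniteEntropy

/-! ### Superposition coding over `n` channel uses. -/

namespace BroadcastChannel

open FiniteEntropy

variable {X Y₁ Y₂ A : Type*} [Fintype Y₁] [Fintype Y₂] (W : BroadcastChannel X Y₁ Y₂)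

theorem joint_nonneg {p : A × X → ℝ} (hp : ∀ t, 0 ≤ p t) (ω : (A × X) × Y₁ × Y₂) :
    0 ≤ W.joint p ω := mul_nonneg (hp _) ((W.prob_mem _).1 _)

variable [Fintype X] [Fintype A]

theorem lawOf_joint_fst (p : A × X → ℝ) : lawOf (W.joint p) Prod.fst = p := by
  ext t
  simp only [lawOf_fst, joint, ← Finset.mul_sum, (W.prob_mem _).2, mul_one]

theorem lawOf_joint {B : Type*} (p : A × X → ℝ) (g : A × X → B) :
    lawOf (W.joint p) (fun ω => g ω.1) = lawOf p g := by
  rw [← lawOf_lawOf (W.joint p) Prod.fst g, lawOf_joint_fst]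

theorem joint_mem_stdSimplex {p : A × X → ℝ} (hp : p ∈ stdSimplex ℝ (A × X)) :
    W.joint p ∈ stdSimplex ℝ ((A × X) × Y₁ × Y₂) :=
  ⟨W.joint_nonneg hp.1, by rw [← sum_lawOf _ Prod.fst, lawOf_joint_fst, hp.2]⟩

/-- Drawing the center, then the codeword, then the outputs yields `n` independent copies of
`W.joint p`, so that missed tests fall under `sum_threshold_fail_le`. -/
theorem sum_blocks {n : ℕ} {p : A × X → ℝ} (hp : ∀ t, 0 ≤ p t)
    (g : (Fin n → A) → (Fin n → X) → (Fin n → Y₁ × Y₂) → ℝ) :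
    ∑ u : Fin n → A, piMass (fun _ => lawOf p Prod.fst) u *
        ∑ x : Fin n → X, piMass (fun i => condKernel p (u i)) x *
          ∑ y, piMass (fun i => W.prob (x i)) y * g u x y =
      ∑ ω : Fin n → (A × X) × Y₁ × Y₂, piMass (fun _ => W.joint p) ω *
        g (fun i => (ω i).1.1) (fun i => (ω i).1.2) (fun i => (ω i).2) := by
  let e : (Fin n → (A × X) × Y₁ × Y₂) ≃ ((Fin n → A) × (Fin n → X)) × (Fin n → Y₁ × Y₂) :=
    (Equiv.arrowProdEquivProdArrow _ _ _).trans
      ((Equiv.arrowProdEquivProdArrow _ _ _).prodCongr (Equiv.refl _))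
  rw [← e.symm.sum_comp, Fintype.sum_prod_type, Fintype.sum_prod_type]
  refine Finset.sum_congr rfl fun u _ => ?_
  rw [Finset.mul_sum]
  refine Finset.sum_congr rfl fun x _ => ?_
  rw [Finset.mul_sum, Finset.mul_sum]
  refine Finset.sum_congr rfl fun y _ => ?_
  have : piMass (fun _ => W.joint p) (e.symm ((u, x), y)) =
      piMass (fun _ => lawOf p Prod.fst) u * piMass (fun i => condKernel p (u i)) x *
        piMass (fun i => W.prob (x i)) y := by
    simp only [piMass, ← Finset.prod_mul_distrib, lawOf_fst_mul_condKernel hp]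
    rfl
  rw [this, mul_assoc, mul_assoc]
  rfl

end BroadcastChannel

namespace BroadcastChannel

open FiniteEntropy

variable {X Y₁ Y₂ A : Type*} [Fintype X] [Fintype Y₁] [Fintype Y₂] [Fintype A]
  (W : BroadcastChannel X Y₁ Y₂)

open Classical in
/-- Superposition coding at block length `n`: an explicit bound on the error probability. -/
theorem exists_code_errorProb_le {p : A × X → ℝ} (hp : p ∈ stdSimplex ℝ (A × X)) :
    ∃ K : ℝ, ∀ {δ : ℝ}, 0 < δ → ∀ {n : ℕ}, 0 < n → ∀ {M₁ M₂ L N : ℕ}, 0 < M₁ → 0 < M₂ →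
      ∀ α : Fin M₁ → Fin L, (∀ w, (Finset.univ.filter fun w' => α w' = α w).card ≤ N) →
      ∃ c : BroadcastCode X Y₁ Y₂ M₁ M₂ n, W.errorProb c ≤ K / (n * δ ^ 2) +
        ((M₂ : ℝ) * L - 1) / 2 ^ (n * (W.auxInfo₂ p id - δ)) +
        ((N : ℝ) - 1) / 2 ^ (n * (W.condInfo₁ p id - δ)) +
        ((M₁ : ℝ) * M₂ - 1) / 2 ^ (n * (W.inputInfo₁ p - δ)) := by
  obtain ⟨P, hPdef⟩ : ∃ P, P = W.joint p := ⟨_, rfl⟩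
  have hP : P ∈ stdSimplex ℝ ((A × X) × Y₁ × Y₂) := hPdef ▸ W.joint_mem_stdSimplex hp
  obtain ⟨PA, hPA⟩ : ∃ PA, PA = lawOf p Prod.fst := ⟨_, rfl⟩
  obtain ⟨PX, hPX⟩ : ∃ PX, PX = lawOf p Prod.snd := ⟨_, rfl⟩
  have lawA : lawOf P (fun ω => ω.1.1) = PA := by rw [hPdef, hPA, W.lawOf_joint p Prod.fst]
  have lawX : lawOf P (fun ω => ω.1.2) = PX := by rw [hPdef, hPX, W.lawOf_joint p Prod.snd]
  obtain ⟨Q, hQdef⟩ : ∃ Q, Q = condKernel p := ⟨_, rfl⟩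
  have hQ : ∀ a, Q a ∈ stdSimplex ℝ X := hQdef ▸ condKernel_mem_stdSimplex hp
  have hPAs : PA ∈ stdSimplex ℝ A := hPA ▸ lawOf_mem_stdSimplex hp _
  obtain ⟨J₂, hJ₂⟩ : ∃ J : A → Y₂ → ℝ, J = fun a y => lawOf P (fun ω => (ω.1.1, ω.2.2)) (a, y) := ⟨_, rfl⟩
  obtain ⟨N₂, hN₂⟩ : ∃ J : Y₂ → ℝ, J = lawOf P fun ω => ω.2.2 := ⟨_, rfl⟩
  obtain ⟨J₀, hJ₀⟩ : ∃ J : X → Y₁ → ℝ, J = fun x y => lawOf P (fun ω => (ω.1.2, ω.2.1)) (x, y) := ⟨_, rfl⟩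
  obtain ⟨N₁, hN₁⟩ : ∃ J : Y₁ → ℝ, J = lawOf P fun ω => ω.2.1 := ⟨_, rfl⟩
  obtain ⟨Jc, hJc⟩ : ∃ J : A → X → Y₁ → ℝ, J = fun a x y => lawOf P (fun ω => (ω.1.2, ω.2.1, ω.1.1)) (x, y, a) := ⟨_, rfl⟩
  obtain ⟨Nc, hNc⟩ : ∃ J : A → Y₁ → ℝ, J = fun a y => lawOf P (fun ω => (ω.2.1, ω.1.1)) (y, a) := ⟨_, rfl⟩
  have hI₂ : W.auxInfo₂ p id = ∑ ω, P ω * (Real.logb 2 (J₂ ω.1.1 ω.2.2) -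
      Real.logb 2 (PA ω.1.1 * N₂ ω.2.2)) := by
    rw [← lawA, hJ₂, hN₂, ← mutualInfo_eq_sum hP.1 (fun ω => ω.1.1) fun ω => ω.2.2, hPdef]
    rfl
  have hI₀ : W.inputInfo₁ p = ∑ ω, P ω * (Real.logb 2 (J₀ ω.1.2 ω.2.1) -
      Real.logb 2 (PX ω.1.2 * N₁ ω.2.1)) := by
    rw [← lawX, hJ₀, hN₁, ← mutualInfo_eq_sum hP.1 (fun ω => ω.1.2) fun ω => ω.2.1, hPdef]
    rfl
  have hQmul : ∀ a x, lawOf P (fun ω => ω.1.1) a * Q a x =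
      lawOf P (fun ω => (ω.1.2, ω.1.1)) (x, a) := by
    intro a x
    rw [lawA, hPA, hQdef, lawOf_fst_mul_condKernel hp.1, hPdef, W.lawOf_joint p fun t => (t.2, t.1),
      lawOf_eq_sum_ite, Finset.sum_eq_single (a, x)]
    · simp
    · rintro ⟨a', x'⟩ _ hne
      refine if_neg fun h => hne ?_
      simp only [Prod.mk.injEq] at h ⊢
      exact ⟨h.2, h.1⟩
    · simp
  have hIc : W.condInfo₁ p id = ∑ ω, P ω * (Real.logb 2 (Jc ω.1.1 ω.1.2 ω.2.1) -
      Real.logb 2 (Q ω.1.1 ω.1.2 * Nc ω.1.1 ω.2.1)) := by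
    rw [hJc, hNc, ← condMutualInfo_eq_sum hP.1 (fun ω => ω.1.2) (fun ω => ω.2.1)
      (fun ω => ω.1.1) hQmul, hPdef]
    rfl
  have J₂0 : ∀ a y, 0 ≤ J₂ a y := by
    rw [hJ₂]
    exact fun a y =>
    lawOf_nonneg hP.1 (fun ω => (ω.1.1, ω.2.2)) (a, y)
  have J₀0 : ∀ x y, 0 ≤ J₀ x y := by
    rw [hJ₀]
    exact fun x y =>
    lawOf_nonneg hP.1 (fun ω => (ω.1.2, ω.2.1)) (x, y)
  have Jc0 : ∀ a x y, 0 ≤ Jc a x y := by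
    rw [hJc]
    exact fun a x y =>
    lawOf_nonneg hP.1 (fun ω => (ω.1.2, ω.2.1, ω.1.1)) (x, y, a)
  have J₂s : ∀ y, ∑ a, J₂ a y = N₂ y := by
    rw [hJ₂, hN₂]
    exact sum_pair_left P (fun ω => ω.1.1) (fun ω => ω.2.2)
  have J₀s : ∀ y, ∑ x, J₀ x y = N₁ y := by
    rw [hJ₀, hN₁]
    exact sum_pair_left P (fun ω => ω.1.2) (fun ω => ω.2.1)
  have Jcs : ∀ a y, ∑ x, Jc a x y = Nc a y := by
    rw [hJc, hNc]
    exact fun a y =>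
    sum_pair_left P (fun ω => ω.1.2) (fun ω => (ω.2.1, ω.1.1)) (y, a)
  have J₂p : ∀ ω, P ω ≠ 0 → 0 < J₂ ω.1.1 ω.2.2 := by
    rw [hJ₂]
    exact fun ω =>
    lawOf_pos hP.1 (fun ω => (ω.1.1, ω.2.2))
  have J₀p : ∀ ω, P ω ≠ 0 → 0 < J₀ ω.1.2 ω.2.1 := by
    rw [hJ₀]
    exact fun ω =>
    lawOf_pos hP.1 (fun ω => (ω.1.2, ω.2.1))
  have Jcp : ∀ ω, P ω ≠ 0 → 0 < Jc ω.1.1 ω.1.2 ω.2.1 := by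
    rw [hJc]
    exact fun ω =>
    lawOf_pos hP.1 (fun ω => (ω.1.2, ω.2.1, ω.1.1))
  have p2 : ∀ ω, P ω ≠ 0 → 0 < PA ω.1.1 * N₂ ω.2.2 := by
    intro ω h
    rw [← lawA, hN₂]
    exact mul_pos (lawOf_pos hP.1 (fun ω => ω.1.1) h) (lawOf_pos hP.1 (fun ω => ω.2.2) h)
  have p0 : ∀ ω, P ω ≠ 0 → 0 < PX ω.1.2 * N₁ ω.2.1 := by
    intro ω h
    rw [← lawX, hN₁]
    exact mul_pos (lawOf_pos hP.1 (fun ω => ω.1.2) h) (lawOf_pos hP.1 (fun ω => ω.2.1) h)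
  have pc : ∀ ω, P ω ≠ 0 → 0 < Q ω.1.1 ω.1.2 * Nc ω.1.1 ω.2.1 := by
    intro ω h
    rw [hNc]
    refine mul_pos ?_ (lawOf_pos hP.1 (fun ω => (ω.2.1, ω.1.1)) h)
    refine ((hQ _).1 _).lt_of_ne' fun h0 => ?_
    have h1 := hQmul ω.1.1 ω.1.2
    rw [h0, mul_zero] at h1
    exact (lawOf_pos hP.1 (fun ω => (ω.1.2, ω.1.1)) h).ne h1
  let V₂ := ∑ ω, P ω * ((Real.logb 2 (J₂ ω.1.1 ω.2.2) - Real.logb 2 (PA ω.1.1 * N₂ ω.2.2)) -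
    W.auxInfo₂ p id) ^ 2
  let V₀ := ∑ ω, P ω * ((Real.logb 2 (J₀ ω.1.2 ω.2.1) - Real.logb 2 (PX ω.1.2 * N₁ ω.2.1)) -
    W.inputInfo₁ p) ^ 2
  let Vc := ∑ ω, P ω * ((Real.logb 2 (Jc ω.1.1 ω.1.2 ω.2.1) -
    Real.logb 2 (Q ω.1.1 ω.1.2 * Nc ω.1.1 ω.2.1)) - W.condInfo₁ p id) ^ 2
  -- The constant is the sum of the variances of the three log-likelihood ratios, hence independent
  -- of `δ`, `n` and the code sizes.
  refine ⟨V₂ + Vc + V₀, fun {δ} hδ {n} hn {M₁ M₂ L N} hM₁ hM₂ α hα => ?_⟩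
  have : NeZero M₁ := ⟨hM₁.ne'⟩
  have : NeZero M₂ := ⟨hM₂.ne'⟩
  set τ₂ : ℝ := 2 ^ (n * (W.auxInfo₂ p id - δ)) with hτ₂
  set τc : ℝ := 2 ^ (n * (W.condInfo₁ p id - δ)) with hτc
  set τ₀ : ℝ := 2 ^ (n * (W.inputInfo₁ p - δ)) with hτ₀
  have τ₂pos : 0 < τ₂ := by positivity
  have τcpos : 0 < τc := by positivity
  have τ₀pos : 0 < τ₀ := by positivity
  obtain ⟨T₂, hT₂⟩ : ∃ T : (Fin n → A) → (Fin n → Y₂) → Prop, ∀ u y, T u y ↔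
      τ₂ * ((∏ i, PA (u i)) * ∏ i, N₂ (y i)) < ∏ i, J₂ (u i) (y i) := ⟨_, fun _ _ => Iff.rfl⟩
  obtain ⟨Tc, hTc⟩ : ∃ T : (Fin n → A) → (Fin n → X) → (Fin n → Y₁) → Prop, ∀ u x y, T u x y ↔
      τc * ((∏ i, Q (u i) (x i)) * ∏ i, Nc (u i) (y i)) < ∏ i, Jc (u i) (x i) (y i) :=
    ⟨_, fun _ _ _ => Iff.rfl⟩
  obtain ⟨T₀, hT₀⟩ : ∃ T : (Fin n → X) → (Fin n → Y₁) → Prop, ∀ x y, T x y ↔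
      τ₀ * ((∏ i, PX (x i)) * ∏ i, N₁ (y i)) < ∏ i, J₀ (x i) (y i) := ⟨_, fun _ _ => Iff.rfl⟩
  -- Receiver 1 runs both tests: `Tc` excludes satellites of the true cloud, `T₀` excludes codewords
  -- of other clouds.
  obtain ⟨T₁, hT₁⟩ : ∃ T : (Fin n → A) → (Fin n → X) → (Fin n → Y₁) → Prop, ∀ u x y, T u x y ↔
      Tc u x y ∧ T₀ x y := ⟨_, fun _ _ _ => Iff.rfl⟩
  have h₂ : ∀ z, ∑ u, piMass (fun _ => PA) u * (if T₂ u z then 1 else 0) ≤ 1 / τ₂ :=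
    sum_piMass_threshold_le (fun _ => J₂0) (fun _ => J₂s) τ₂pos fun u y => (hT₂ u y).1
  have h_c : ∀ u z, ∑ x, piMass (fun i => Q (u i)) x * (if Tc u x z then 1 else 0) ≤ 1 / τc :=
    fun u => sum_piMass_threshold_le (fun i => Jc0 (u i)) (fun i => Jcs (u i))
      τcpos fun x y => (hTc u x y).1
  have h₀ : ∀ z, ∑ x, piMass (fun _ => PX) x * (if T₀ x z then 1 else 0) ≤ 1 / τ₀ :=
    sum_piMass_threshold_le (fun _ => J₀0) (fun _ => J₀s) τ₀pos fun x y => (hT₀ x y).1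
  -- Averaged over its center, a codeword is i.i.d. with the input law; this reduces the other
  -- clouds to `T₀` alone.
  have hmarg : ∀ x, ∑ u, piMass (fun _ : Fin n => PA) u * piMass (fun i => Q (u i)) x =
      piMass (fun _ => PX) x := by
    intro x
    simp only [piMass, ← Finset.prod_mul_distrib]
    rw [← Fintype.prod_sum fun i a => PA a * Q a (x i)]
    refine Finset.prod_congr rfl fun i _ => ?_
    simp only [hPA, hQdef, lawOf_fst_mul_condKernel hp.1, hPX, lawOf_snd]
  have ite_mono {a b : Prop} (h : a → b) : (if a then (1 : ℝ) else 0) ≤ if b then 1 else 0 := by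
    split_ifs with h1 h2
    · exact le_rfl
    · exact absurd (h h1) h2
    · exact zero_le_one
    · exact le_rfl
  -- The cloud of `(w₁, w₂)` is `(w₂, α w₁)`. Two messages in one cloud share `w₂` and the value of
  -- `α`, so a cloud has at most `N` members.
  obtain ⟨x, d₁, d₂, hcode⟩ := exists_superposition_code (M := Fin M₁ × Fin M₂)
    (C := Fin M₂ × Fin L) (PU := piMass fun _ : Fin n => PA) (Q := fun u => piMass fun i => Q (u i))
    (V := fun x => piMass fun i => W.prob (x i)) (piMass_mem_stdSimplex fun _ => hPAs)
    (fun u => piMass_mem_stdSimplex fun i => hQ (u i))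
    (fun x => piMass_mem_stdSimplex fun i => W.prob_mem (x i))
    (fun y i => (y i).1) (fun y i => (y i).2) T₁ T₂
    (fun m => (m.2, α m.1)) (one_div_pos.2 τ₀pos).le (one_div_pos.2 τcpos).le h₂
    (fun u z => (Finset.sum_le_sum fun x _ => mul_le_mul_of_nonneg_left (ite_mono fun h => ((hT₁ _ _ _).1 h).1)
      (piMass_nonneg (fun i => (hQ (u i)).1) x)).trans (h_c u z))
    (fun z => by
      refine (Finset.sum_le_sum fun u _ => mul_le_mul_of_nonneg_left
        (Finset.sum_le_sum fun x _ => mul_le_mul_of_nonneg_left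
          (ite_mono fun h => ((hT₁ _ _ _).1 h).2) (piMass_nonneg (fun i => (hQ (u i)).1) x))
        (piMass_nonneg (fun _ => hPAs.1) u)).trans ((le_of_eq ?_).trans (h₀ z))
      simp only [Finset.mul_sum]
      rw [Finset.sum_comm]
      simp only [← mul_assoc, ← Finset.sum_mul, hmarg])
    (N := N) (by
      intro m
      refine le_trans ?_ (hα m.1)
      refine Finset.card_le_card_of_injOn Prod.fst ?_ ?_
      · intro m' hm'
        simp only [Finset.coe_filter, Finset.mem_univ, true_and, Set.mem_ofPred_eq,
          Prod.mk.injEq] at hm' ⊢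
        exact hm'.2
      · intro m' hm' m'' hm'' h
        simp only [Finset.coe_filter, Finset.mem_univ, true_and, Set.mem_ofPred_eq,
          Prod.mk.injEq] at hm' hm''
        exact Prod.ext h (hm'.1.trans hm''.1.symm))
  -- Each receiver recovers more than its own message and discards the rest.
  refine ⟨⟨fun w₁ w₂ => x (w₁, w₂), fun z => (d₁ z).1, fun z => (d₂ z).1⟩, ?_⟩
  have hM₁' : (0 : ℝ) < M₁ := by exact_mod_cast hM₁
  have hM₂' : (0 : ℝ) < M₂ := by exact_mod_cast hM₂
  rw [hPA, hQdef, sum_blocks W hp.1 fun u x y => ((if T₂ u (fun i => (y i).2) then (0 : ℝ) else 1) +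
      (if T₁ u x (fun i => (y i).1) then 0 else 1)), ← hPdef] at hcode
  have hmiss : ∑ ω : Fin n → (A × X) × Y₁ × Y₂, piMass (fun _ => P) ω *
      ((if T₂ (fun i => (ω i).1.1) (fun i => (ω i).2.2) then (0 : ℝ) else 1) +
        (if T₁ (fun i => (ω i).1.1) (fun i => (ω i).1.2) (fun i => (ω i).2.1) then 0 else 1)) ≤
      (V₂ + Vc + V₀) / (n * δ ^ 2) := by
    have e2 := sum_threshold_fail_le hP J₂p p2 hδ hI₂ hn
      (T := fun ω => T₂ (fun i => (ω i).1.1) (fun i => (ω i).2.2))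
      (fun ω h => (hT₂ _ _).2 (by simpa only [Finset.prod_mul_distrib] using h))
    have ec := sum_threshold_fail_le hP Jcp pc hδ hIc hn
      (T := fun ω => Tc (fun i => (ω i).1.1) (fun i => (ω i).1.2) (fun i => (ω i).2.1))
      (fun ω h => (hTc _ _ _).2 (by simpa only [Finset.prod_mul_distrib] using h))
    have e0 := sum_threshold_fail_le hP J₀p p0 hδ hI₀ hn
      (T := fun ω => T₀ (fun i => (ω i).1.2) (fun i => (ω i).2.1))
      (fun ω h => (hT₀ _ _).2 (by simpa only [Finset.prod_mul_distrib] using h))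
    rw [add_div, add_div]
    refine le_trans ?_ (add_le_add (add_le_add e2 ec) e0)
    rw [← Finset.sum_add_distrib, ← Finset.sum_add_distrib]
    refine Finset.sum_le_sum fun ω _ => ?_
    rw [← mul_add, ← mul_add, add_assoc]
    refine mul_le_mul_of_nonneg_left (add_le_add le_rfl ?_) (piMass_nonneg (fun _ => hP.1) ω)
    by_cases hc : Tc (fun i => (ω i).1.1) (fun i => (ω i).1.2) (fun i => (ω i).2.1)
    · by_cases h0 : T₀ (fun i => (ω i).1.2) (fun i => (ω i).2.1)
      · rw [if_pos ((hT₁ _ _ _).2 ⟨hc, h0⟩), if_pos hc, if_pos h0, add_zero]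
      · rw [if_neg fun h => h0 ((hT₁ _ _ _).1 h).2, if_pos hc, if_neg h0, zero_add]
    · rw [if_neg fun h => hc ((hT₁ _ _ _).1 h).1, if_neg hc]
      exact le_add_of_nonneg_right (by split_ifs <;> norm_num)
  rw [errorProb, one_div, inv_mul_le_iff₀ (mul_pos hM₁' hM₂')]
  refine le_trans ?_ (hcode.trans ?_)
  · rw [Fintype.sum_prod_type]
    refine Finset.sum_le_sum fun w₁ _ => Finset.sum_le_sum fun w₂ _ =>
      Finset.sum_le_sum fun y _ => ?_
    dsimp only
    split_ifs with h1 h2 h2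
    · exact le_rfl
    · refine absurd ?_ h2
      exact h1.imp (fun h h' => h (congrArg Prod.fst h')) fun h h' => h (congrArg Prod.fst h')
    · exact piMass_nonneg (fun i => (W.prob_mem _).1) y
    · exact le_rfl
  · simp only [Fintype.card_prod, Fintype.card_fin, Nat.cast_mul, mul_one_div]
    refine mul_le_mul_of_nonneg_left ?_ (mul_pos hM₁' hM₂').le
    gcongr

end BroadcastChannel

namespace BroadcastChannel

open FiniteEntropy

/-! ### Functions of the auxiliary variable. -/

section Push

variable {X Y₁ Y₂ A B C : Type*} [Fintype X] [Fintype Y₁] [Fintype Y₂] [Fintype A] (W : BroadcastChannel X Y₁ Y₂)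

/-- The joint mass function of `(b A, X)`. -/
noncomputable def mapAux (p : A × X → ℝ) (b : A → B) : B × X → ℝ := lawOf p fun t => (b t.1, t.2)

/-- The channel sees only `X`, so merging auxiliary values commutes with attaching the outputs.
Information about `b A` can thus be computed from the reduced law. -/
theorem joint_mapAux (p : A × X → ℝ) (b : A → B) :
    W.joint (mapAux p b) = lawOf (W.joint p) fun ω => ((b ω.1.1, ω.1.2), ω.2) := by
  classical
  ext ⟨⟨c, x⟩, y⟩
  rw [lawOf_eq_sum_ite, Fintype.sum_prod_type]
  simp only [joint, mapAux, lawOf_eq_sum_ite, Finset.sum_mul]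
  refine Finset.sum_congr rfl fun t _ => ?_
  rw [Finset.sum_eq_single y]
  · by_cases h : (b t.1, t.2) = (c, x)
    · rw [if_pos h, if_pos (by rw [h])]
      rw [Prod.mk.injEq] at h
      rw [h.2]
    · rw [if_neg h, if_neg fun h' => h (Prod.ext_iff.1 h').1, zero_mul]
  · intro y' _ hy
    exact if_neg fun h => hy (Prod.ext_iff.1 h).2
  · simp

variable [Fintype B] [Fintype C]

theorem mapAux_mem_stdSimplex {p : A × X → ℝ} (hp : p ∈ stdSimplex ℝ (A × X)) (b : A → B) :
    mapAux p b ∈ stdSimplex ℝ (B × X) := lawOf_mem_stdSimplex hp _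

theorem lawOf_mapAux_snd (p : A × X → ℝ) (b : A → B) :
    lawOf (mapAux p b) Prod.snd = lawOf p Prod.snd := lawOf_lawOf p _ _

theorem auxInfo₂_mapAux (p : A × X → ℝ) (b : A → B) (c : B → C) :
    W.auxInfo₂ (mapAux p b) c = W.auxInfo₂ p (fun a => c (b a)) := by
  simp only [auxInfo₂, mutualInfo, joint_mapAux, entropy_lawOf]

theorem condInfo₁_mapAux (p : A × X → ℝ) (b : A → B) (c : B → C) :
    W.condInfo₁ (mapAux p b) c = W.condInfo₁ p (fun a => c (b a)) := by
  simp only [condInfo₁, condMutualInfo, joint_mapAux, entropy_lawOf]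

theorem condInfo₂_mapAux (p : A × X → ℝ) (b : A → B) (c : B → C) :
    W.condInfo₂ (mapAux p b) c = W.condInfo₂ p (fun a => c (b a)) := by
  simp only [condInfo₂, condMutualInfo, joint_mapAux, entropy_lawOf]

theorem inputInfo₁_mapAux (p : A × X → ℝ) (b : A → B) :
    W.inputInfo₁ (mapAux p b) = W.inputInfo₁ p := by
  simp only [inputInfo₁, mutualInfo, joint_mapAux, entropy_lawOf]

theorem condInfo₁_of_subsingleton [Subsingleton B] {p : A × X → ℝ}
    (hp : p ∈ stdSimplex ℝ (A × X)) (b : A → B) : W.condInfo₁ p b = W.inputInfo₁ p := by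
  rw [condInfo₁, condMutualInfo, inputInfo₁, mutualInfo,
    entropy_of_subsingleton (W.joint_mem_stdSimplex hp) fun ω => b ω.1.1,
    entropy_congr _ (f := fun ω : (A × X) × Y₁ × Y₂ => (ω.1.2, b ω.1.1)) (g := fun ω => ω.1.2)
      fun ω ω' => by simp [Subsingleton.elim (b ω.1.1) (b ω'.1.1)],
    entropy_congr _ (f := fun ω : (A × X) × Y₁ × Y₂ => (ω.2.1, b ω.1.1)) (g := fun ω => ω.2.1)
      fun ω ω' => by simp [Subsingleton.elim (b ω.1.1) (b ω'.1.1)],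
    entropy_congr _ (f := fun ω : (A × X) × Y₁ × Y₂ => (ω.1.2, ω.2.1, b ω.1.1))
      (g := fun ω => (ω.1.2, ω.2.1))
      fun ω ω' => by simp [Subsingleton.elim (b ω.1.1) (b ω'.1.1)], sub_zero]

end Push

/-! ### Exponential estimates for the sizes of message sets. -/

section Rates

theorem one_le_two_rpow {x : ℝ} (hx : 0 ≤ x) : (1 : ℝ) ≤ 2 ^ x :=
  Real.one_le_rpow one_le_two hx

theorem ceil_two_rpow_le {x : ℝ} (hx : 0 ≤ x) : (⌈(2 : ℝ) ^ x⌉₊ : ℝ) ≤ 2 * 2 ^ x := by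
  have := (Nat.ceil_lt_add_one (show (0 : ℝ) ≤ 2 ^ x by positivity)).le
  linarith [one_le_two_rpow hx]

theorem ceil_two_rpow_pos (x : ℝ) : 0 < ⌈(2 : ℝ) ^ x⌉₊ := Nat.ceil_pos.2 (by positivity)

theorem two_rpow_div_le {a b c : ℝ} (h : a + c ≤ b) : (2 : ℝ) ^ a / 2 ^ b ≤ 2 ^ (-c) := by
  rw [← Real.rpow_sub two_pos]
  exact Real.rpow_le_rpow_of_exponent_le one_le_two (by linarith)

/-- At rate zero there is a single message, and the `- 1` for the true one makes the numerator
vanish: no slack in the exponent is needed. -/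
theorem ceil_two_rpow_sub_one_div_le {n : ℕ} {ρ γ δ : ℝ} (hρ : ρ + δ ≤ γ ∨ ρ = 0) :
    ((⌈(2 : ℝ) ^ ((n : ℝ) * ρ)⌉₊ : ℝ) - 1) / 2 ^ ((n : ℝ) * γ) ≤ 2 ^ (-((n : ℝ) * δ)) := by
  rcases hρ with h | rfl
  · refine le_trans ?_ (two_rpow_div_le (a := n * ρ) (b := n * γ) ?_)
    · have := (Nat.ceil_lt_add_one (show (0 : ℝ) ≤ 2 ^ ((n : ℝ) * ρ) by positivity)).le
      gcongr
      linarith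
    · rw [← mul_add]
      gcongr
  · simp
    positivity

theorem tendsto_two_rpow_neg {δ : ℝ} (hδ : 0 < δ) :
    Tendsto (fun n : ℕ => (2 : ℝ) ^ (-((n : ℝ) * δ))) atTop (𝓝 0) := by
  have h : ∀ n : ℕ, (2 : ℝ) ^ (-((n : ℝ) * δ)) = ((2 : ℝ) ^ (-δ)) ^ n := fun n => by
    rw [← Real.rpow_natCast, ← Real.rpow_mul two_pos.le]
    congr 1
    ring
  simp only [h]
  exact tendsto_pow_atTop_nhds_zero_of_lt_one (by positivity)
    (Real.rpow_lt_one_of_one_lt_of_neg one_lt_two (by linarith))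

theorem tendsto_const_div_nat_mul (K c : ℝ) :
    Tendsto (fun n : ℕ => K / ((n : ℝ) * c)) atTop (𝓝 0) := by
  have := (tendsto_const_div_atTop_nhds_zero_nat (K / c))
  refine this.congr fun n => ?_
  rw [div_div, mul_comm]

end Rates

/-! ### Achievability of the superposition region. -/

section Achievability

variable {X Y₁ Y₂ A : Type*} [Fintype Y₁] [Fintype Y₂] (W : BroadcastChannel X Y₁ Y₂)

theorem errorProb_nonneg {M₁ M₂ n : ℕ} (c : BroadcastCode X Y₁ Y₂ M₁ M₂ n) :
    0 ≤ W.errorProb c := by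
  refine mul_nonneg (by positivity) (Finset.sum_nonneg fun _ _ => Finset.sum_nonneg fun _ _ =>
    Finset.sum_nonneg fun y _ => ?_)
  split_ifs
  · exact Finset.prod_nonneg fun i _ => (W.prob_mem _).1 _
  · exact le_rfl

theorem achievable_of_errorProb_le {R : ℝ × ℝ} (h₁ : 0 ≤ R.1) (h₂ : 0 ≤ R.2) {b : ℕ → ℝ}
    (hb : Tendsto b atTop (𝓝 0))
    (h : ∀ n : ℕ, 0 < n → ∃ c : BroadcastCode X Y₁ Y₂ ⌈(2 : ℝ) ^ ((n : ℝ) * R.1)⌉₊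
      ⌈(2 : ℝ) ^ ((n : ℝ) * R.2)⌉₊ n, W.errorProb c ≤ b n) : W.Achievable R := by
  have hc : ∀ n : ℕ, ∃ c : BroadcastCode X Y₁ Y₂ ⌈(2 : ℝ) ^ ((n : ℝ) * R.1)⌉₊
      ⌈(2 : ℝ) ^ ((n : ℝ) * R.2)⌉₊ n, 0 < n → W.errorProb c ≤ b n := by
    intro n
    rcases n.eq_zero_or_pos with rfl | hn
    -- `Achievable` also asks for a code at block length zero, where any code will do.
    · exact ⟨⟨fun _ _ i => i.elim0, fun _ => ⟨0, ceil_two_rpow_pos _⟩,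
        fun _ => ⟨0, ceil_two_rpow_pos _⟩⟩, fun h => absurd h (lt_irrefl _)⟩
    · obtain ⟨c, hc⟩ := h n hn
      exact ⟨c, fun _ => hc⟩
  choose c hc using hc
  refine ⟨h₁, h₂, c, squeeze_zero' (Eventually.of_forall fun n => W.errorProb_nonneg _) ?_ hb⟩
  filter_upwards [eventually_gt_atTop 0] with n hn using hc n hn

variable [Fintype X] [Fintype A]

/-- Rate splitting: `r`, just below `I(X;Y₁|U)`, is the rate of the satellites in a cloud, and the
remaining `R₁ - r` moves to the cloud, where the sum constraint leaves room for it. -/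
theorem achievable_of_lt {p : A × X → ℝ} (hp : p ∈ stdSimplex ℝ (A × X)) {R₁ R₂ : ℝ}
    (h₁ : 0 ≤ R₁) (h₂ : 0 ≤ R₂) (h_a : R₂ < W.auxInfo₂ p id)
    (h_b : R₁ + R₂ < W.auxInfo₂ p id + W.condInfo₁ p id) (h_c : R₁ + R₂ < W.inputInfo₁ p) :
    W.Achievable (R₁, R₂) := by
  classical
  obtain ⟨K, hK⟩ := W.exists_code_errorProb_le hp
  obtain ⟨δ, hδ, hδa, hδb, hδc⟩ : ∃ δ : ℝ, 0 < δ ∧ R₂ + 4 * δ ≤ W.auxInfo₂ p id ∧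
      R₁ + R₂ + 4 * δ ≤ W.auxInfo₂ p id + W.condInfo₁ p id ∧
      R₁ + R₂ + 4 * δ ≤ W.inputInfo₁ p := by
    refine ⟨min (W.auxInfo₂ p id - R₂) (min (W.auxInfo₂ p id + W.condInfo₁ p id - (R₁ + R₂))
      (W.inputInfo₁ p - (R₁ + R₂))) / 4, ?_, ?_, ?_, ?_⟩
    · have : 0 < min (W.auxInfo₂ p id - R₂) (min (W.auxInfo₂ p id + W.condInfo₁ p id - (R₁ + R₂))
        (W.inputInfo₁ p - (R₁ + R₂))) := lt_min (by linarith) (lt_min (by linarith) (by linarith))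
      linarith
    · have := min_le_left (W.auxInfo₂ p id - R₂) (min (W.auxInfo₂ p id + W.condInfo₁ p id -
        (R₁ + R₂)) (W.inputInfo₁ p - (R₁ + R₂)))
      linarith
    · have := (min_le_right (W.auxInfo₂ p id - R₂) (min (W.auxInfo₂ p id + W.condInfo₁ p id -
        (R₁ + R₂)) (W.inputInfo₁ p - (R₁ + R₂)))).trans (min_le_left _ _)
      linarith
    · have := (min_le_right (W.auxInfo₂ p id - R₂) (min (W.auxInfo₂ p id + W.condInfo₁ p id -
        (R₁ + R₂)) (W.inputInfo₁ p - (R₁ + R₂)))).trans (min_le_right _ _)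
      linarith
  -- The truncation at zero covers `I(X;Y₁|U) < 2δ`: a cloud then has one satellite, and nothing has
  -- to be resolved inside it.
  obtain ⟨r, hr0, hr1, hr2⟩ : ∃ r : ℝ, 0 ≤ r ∧ W.condInfo₁ p id ≤ r + 2 * δ ∧
      (r + δ ≤ W.condInfo₁ p id - δ ∨ r = 0) := by
    refine ⟨max 0 (W.condInfo₁ p id - 2 * δ), le_max_left _ _, ?_, ?_⟩
    · linarith [le_max_right 0 (W.condInfo₁ p id - 2 * δ)]
    · rcases le_total 0 (W.condInfo₁ p id - 2 * δ) with h | h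
      · left
        rw [max_eq_right h]
        linarith
      · exact Or.inr (max_eq_left h)
  refine W.achievable_of_errorProb_le h₁ h₂
    (b := fun n => K / (n * δ ^ 2) + 6 * 2 ^ (-((n : ℝ) * δ)) + 2 ^ (-((n : ℝ) * δ)) +
      4 * 2 ^ (-((n : ℝ) * δ))) ?_ fun n hn => ?_
  · have e := tendsto_two_rpow_neg hδ
    simpa using (((tendsto_const_div_nat_mul K (δ ^ 2)).add (e.const_mul 6)).add e).add
      (e.const_mul 4)
  dsimp only
  have hM₁ := ceil_two_rpow_pos (n * R₁)
  have hM₂ := ceil_two_rpow_pos (n * R₂)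
  have hB := ceil_two_rpow_pos (n * r)
  have uM₁ := ceil_two_rpow_le (mul_nonneg n.cast_nonneg h₁)
  have uM₂ := ceil_two_rpow_le (mul_nonneg n.cast_nonneg h₂)
  have lB := Nat.le_ceil ((2 : ℝ) ^ ((n : ℝ) * r))
  have eB := ceil_two_rpow_sub_one_div_le (n := n) hr2
  set M₁ := ⌈(2 : ℝ) ^ ((n : ℝ) * R₁)⌉₊
  set M₂ := ⌈(2 : ℝ) ^ ((n : ℝ) * R₂)⌉₊
  set B := ⌈(2 : ℝ) ^ ((n : ℝ) * r)⌉₊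
  -- The first message `w` is written in base `B`: the quotient selects the cloud, the remainder the
  -- satellite.
  obtain ⟨c, hc⟩ := hK hδ hn hM₁ hM₂ (L := M₁ / B + 1) (N := B)
    (fun w => ⟨w / B, Nat.lt_succ_of_le (Nat.div_le_div_right w.2.le)⟩) (by
      intro w
      refine le_trans (b := (Finset.univ : Finset (Fin B)).card)
        (Finset.card_le_card_of_injOn (fun w' => ⟨w' % B, Nat.mod_lt _ hB⟩) (by simp) ?_)
        (Finset.card_fin B).le
      intro a ha b hb hab
      simp only [Finset.coe_filter, Finset.mem_univ, true_and, Set.mem_ofPred_eq,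
        Fin.mk.injEq] at ha hb hab
      exact Fin.ext (by rw [← Nat.div_add_mod a B, ← Nat.div_add_mod b B, ha, hb, hab]))
  refine ⟨c, hc.trans (add_le_add (add_le_add (add_le_add le_rfl ?_) eB) ?_)⟩
  · have hL : ((M₁ / B + 1 : ℕ) : ℝ) ≤ 2 * 2 ^ (n * (R₁ - r)) + 1 := by
      push_cast
      gcongr
      calc ((M₁ / B : ℕ) : ℝ) ≤ (M₁ : ℝ) / B := Nat.cast_div_le
        _ ≤ (2 * 2 ^ (n * R₁)) / 2 ^ (n * r) := by gcongr
        _ = _ := by rw [mul_div_assoc, ← Real.rpow_sub two_pos, ← mul_sub]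
    calc ((M₂ : ℝ) * (M₁ / B + 1 : ℕ) - 1) / 2 ^ (n * (W.auxInfo₂ p id - δ))
        ≤ (2 * 2 ^ (n * R₂) * (2 * 2 ^ (n * (R₁ - r)) + 1)) /
            2 ^ (n * (W.auxInfo₂ p id - δ)) := by
          gcongr
          refine (sub_le_self _ zero_le_one).trans ?_
          gcongr
      _ = 4 * (2 ^ (n * (R₁ + R₂ - r)) / 2 ^ (n * (W.auxInfo₂ p id - δ))) +
          2 * (2 ^ (n * R₂) / 2 ^ (n * (W.auxInfo₂ p id - δ))) := by
          have : (2 : ℝ) ^ (n * (R₁ + R₂ - r)) = 2 ^ (n * R₂) * 2 ^ (n * (R₁ - r)) := by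
            rw [← Real.rpow_add two_pos]
            congr 1
            ring
          rw [this]
          ring
      _ ≤ 4 * 2 ^ (-((n : ℝ) * δ)) + 2 * 2 ^ (-((n : ℝ) * δ)) := by
          gcongr
          · refine two_rpow_div_le ?_
            rw [← mul_add]
            gcongr
            linarith
          · refine two_rpow_div_le ?_
            rw [← mul_add]
            gcongr
            linarith
      _ = _ := by ring
  · calc ((M₁ : ℝ) * M₂ - 1) / 2 ^ (n * (W.inputInfo₁ p - δ))
        ≤ (2 * 2 ^ (n * R₁) * (2 * 2 ^ (n * R₂))) / 2 ^ (n * (W.inputInfo₁ p - δ)) := by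
          gcongr
          refine (sub_le_self _ zero_le_one).trans ?_
          gcongr
      _ = 4 * (2 ^ (n * (R₁ + R₂)) / 2 ^ (n * (W.inputInfo₁ p - δ))) := by
          rw [mul_add, Real.rpow_add two_pos]
          ring
      _ ≤ _ := by
          gcongr
          refine two_rpow_div_le ?_
          rw [← mul_add]
          gcongr
          linarith

/-- The boundary `R₂ = 0` escapes `achievable_of_lt` when `I(U;Y₂) = 0`. A constant auxiliary
handles it: there is one cloud, and its error term is zero. -/
theorem achievable_of_lt_inputInfo₁ {p : A × X → ℝ} (hp : p ∈ stdSimplex ℝ (A × X)) {R₁ : ℝ}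
    (h₁ : 0 ≤ R₁) (h : R₁ < W.inputInfo₁ p ∨ R₁ = 0) : W.Achievable (R₁, 0) := by
  classical
  have hp' := mapAux_mem_stdSimplex hp fun _ => ()
  obtain ⟨K, hK⟩ := W.exists_code_errorProb_le hp'
  have hI : W.condInfo₁ (mapAux p fun _ => ()) id = W.inputInfo₁ p := by
    rw [W.condInfo₁_of_subsingleton hp', inputInfo₁_mapAux]
  rw [hI, inputInfo₁_mapAux] at hK
  obtain ⟨δ, hδ, hδ'⟩ : ∃ δ : ℝ, 0 < δ ∧ (R₁ + δ ≤ W.inputInfo₁ p - δ ∨ R₁ = 0) := by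
    rcases h with h | h
    · exact ⟨(W.inputInfo₁ p - R₁) / 2, by linarith, Or.inl (by linarith)⟩
    · exact ⟨1, one_pos, Or.inr h⟩
  refine W.achievable_of_errorProb_le h₁ le_rfl
    (b := fun n => K / (n * δ ^ 2) + 0 + 2 ^ (-((n : ℝ) * δ)) + 2 ^ (-((n : ℝ) * δ)))
    ?_ fun n hn => ?_
  · have e := tendsto_two_rpow_neg hδ
    simpa using ((tendsto_const_div_nat_mul K (δ ^ 2)).add e).add e
  dsimp only
  have hM₂ : ⌈(2 : ℝ) ^ ((n : ℝ) * 0)⌉₊ = 1 := by simp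
  have eB := ceil_two_rpow_sub_one_div_le (n := n) hδ'
  obtain ⟨c, hc⟩ := hK hδ hn (ceil_two_rpow_pos (n * R₁)) (ceil_two_rpow_pos (n * 0)) (L := 1)
    (N := ⌈(2 : ℝ) ^ ((n : ℝ) * R₁)⌉₊) (fun _ => 0) (by simp)
  refine ⟨c, hc.trans (add_le_add (add_le_add (add_le_add le_rfl ?_) eB) ?_)⟩
  · rw [hM₂]
    simp
  · rw [hM₂]
    simpa using eB

theorem superpositionRegion_subset_capacityRegion (D : Set (X → ℝ)) :
    W.superpositionRegion D ⊆ W.capacityRegion := by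
  rintro ⟨R₁, R₂⟩ ⟨h₁, h₂, k, p, hp, -, h_a, h_b, h_c⟩
  dsimp only at h₁ h₂ h_a h_b h_c
  have hlt : ∀ {r : ℝ}, 0 < r → ∀ᶠ t : ℝ in 𝓝[>] 0, 0 < t ∧ t < r := fun hr => Ioo_mem_nhdsGT hr
  rcases h₂.eq_or_lt with rfl | h₂
  · rcases h₁.eq_or_lt with rfl | h₁
    · exact subset_closure (W.achievable_of_lt_inputInfo₁ hp le_rfl (Or.inr rfl))
    · refine mem_closure_of_tendsto (b := 𝓝[>] (0 : ℝ)) (f := fun t => (R₁ - t, (0 : ℝ))) ?_ ?_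
      · refine Tendsto.mono_left ?_ nhdsWithin_le_nhds
        refine Continuous.tendsto' (by fun_prop) _ _ (by simp)
      · filter_upwards [hlt h₁] with t ht
        exact W.achievable_of_lt_inputInfo₁ hp (by linarith) (Or.inl (by linarith))
  -- Lowering `R₂` alone makes all three constraints strict.
  · refine mem_closure_of_tendsto (b := 𝓝[>] (0 : ℝ)) (f := fun t => (R₁, R₂ - t)) ?_ ?_
    · refine Tendsto.mono_left ?_ nhdsWithin_le_nhds
      refine Continuous.tendsto' (by fun_prop) _ _ (by simp)
    · filter_upwards [hlt h₂] with t ht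
      exact W.achievable_of_lt hp h₁ (by linarith) (by linarith) (by linarith) (by linarith)

end Achievability

end BroadcastChannel

namespace FiniteEntropy

/-! ### Entropy of mass functions, and compactness of convex hulls. -/

section MassEntropy

variable {α β Ω : Type*} [Fintype α] [Fintype β] [Fintype Ω]

/-- The entropy in bits of a mass function. -/
noncomputable def massEntropy (q : α → ℝ) : ℝ := -∑ a, q a * Real.logb 2 (q a)

theorem entropy_eq_massEntropy (P : Ω → ℝ) (f : Ω → α) : entropy P f = massEntropy (lawOf P f) :=
  rfl

theorem massEntropy_eq_sum_negMulLog (q : α → ℝ) :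
    massEntropy q = (∑ a, Real.negMulLog (q a)) / Real.log 2 := by
  rw [massEntropy, ← Finset.sum_neg_distrib, Finset.sum_div]
  refine Finset.sum_congr rfl fun a _ => ?_
  rw [Real.negMulLog, Real.logb]
  ring

theorem continuous_massEntropy : Continuous (massEntropy : (α → ℝ) → ℝ) := by
  have : (massEntropy : (α → ℝ) → ℝ) = fun q => (∑ a, Real.negMulLog (q a)) / Real.log 2 :=
    funext massEntropy_eq_sum_negMulLog
  rw [this]
  exact (continuous_finsetSum _ fun a _ =>
    Real.continuous_negMulLog.comp (continuous_apply a)).div_const _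

theorem sum_mul_massEntropy_le {ι : Type*} {s : Finset ι} {w : ι → ℝ} (hw : ∀ i ∈ s, 0 ≤ w i)
    (hw1 : ∑ i ∈ s, w i = 1) {q : ι → α → ℝ} (hq : ∀ i ∈ s, ∀ a, 0 ≤ q i a) :
    ∑ i ∈ s, w i * massEntropy (q i) ≤ massEntropy fun a => ∑ i ∈ s, w i * q i a := by
  simp only [massEntropy_eq_sum_negMulLog, ← mul_div_assoc]
  rw [← Finset.sum_div]
  refine div_le_div_of_nonneg_right ?_ (Real.log_pos one_lt_two).le
  simp only [Finset.mul_sum]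
  rw [Finset.sum_comm]
  exact Finset.sum_le_sum fun a _ => Real.concaveOn_negMulLog.le_map_sum hw hw1
    fun i hi => hq i hi a

/-- The chain rule `H(f, g) - H(f) = ∑ P(f = c) H(g | f = c)`. -/
theorem entropy_pair_sub {P : Ω → ℝ} (f : Ω → α) (g : Ω → β) {κ : α → β → ℝ}
    (hκ : ∀ c, ∑ y, κ c y = 1)
    (h : ∀ c y, lawOf P (fun ω => (f ω, g ω)) (c, y) = lawOf P f c * κ c y) :
    entropy P (fun ω => (f ω, g ω)) - entropy P f = ∑ c, lawOf P f c * massEntropy (κ c) := by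
  rw [entropy, entropy, sub_neg_eq_add, neg_add_eq_sub, ← sub_eq_zero, Fintype.sum_prod_type]
  simp only [h]
  rw [← Finset.sum_sub_distrib, ← Finset.sum_sub_distrib]
  refine Finset.sum_eq_zero fun c _ => ?_
  have e : ∀ y, lawOf P f c * κ c y * Real.logb 2 (lawOf P f c * κ c y) =
      lawOf P f c * Real.logb 2 (lawOf P f c) * κ c y +
        lawOf P f c * (κ c y * Real.logb 2 (κ c y)) := by
    intro y
    by_cases h1 : lawOf P f c = 0
    · simp [h1]
    by_cases h2 : κ c y = 0
    · simp [h2]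
    rw [Real.logb_mul h1 h2]
    ring
  simp only [e, Finset.sum_add_distrib, ← Finset.mul_sum, hκ, massEntropy]
  ring

theorem entropy_of_uniform [Nonempty α] {P : Ω → ℝ} {f : Ω → α}
    (h : ∀ a, lawOf P f a = 1 / Fintype.card α) : entropy P f = Real.logb 2 (Fintype.card α) := by
  have : (Fintype.card α : ℝ) ≠ 0 := by exact_mod_cast Fintype.card_ne_zero
  simp only [entropy, h, Finset.sum_const, Finset.card_univ, nsmul_eq_mul]
  rw [one_div, Real.logb_inv]
  field_simp

theorem massEntropy_piMass {ι : Type*} [Fintype ι] [DecidableEq ι] {q : ι → α → ℝ}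
    (hq : ∀ i, q i ∈ stdSimplex ℝ α) : massEntropy (piMass q) = ∑ i, massEntropy (q i) := by
  have e : ∀ y, piMass q y * Real.logb 2 (piMass q y) =
      ∑ i, piMass q y * Real.logb 2 (q i (y i)) := by
    intro y
    by_cases h : piMass q y = 0
    · simp [h]
    rw [← Finset.mul_sum, ← Real.logb_prod]
    · rfl
    · rw [piMass, ← ne_eq, Finset.prod_ne_zero_iff] at h
      exact fun i hi => h i hi
  simp only [massEntropy, e]
  rw [Finset.sum_comm, ← Finset.sum_neg_distrib]
  refine Finset.sum_congr rfl fun i _ => ?_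
  rw [sum_piMass_mul_apply (fun i => (hq i).2) i fun b => Real.logb 2 (q i b)]

theorem lawOf_piMass {ι γ : Type*} [Fintype ι] [DecidableEq ι] (q : ι → α → ℝ) (g : α → γ) :
    lawOf (piMass q) (fun y i => g (y i)) = piMass fun i => lawOf (q i) g := by
  classical
  ext z
  rw [lawOf_eq_sum_ite, piMass]
  simp only [lawOf_eq_sum_ite]
  rw [Fintype.prod_sum]
  refine Finset.sum_congr rfl fun y _ => ?_
  by_cases h : ∀ i, g (y i) = z i
  · rw [if_pos (funext h)]
    exact Finset.prod_congr rfl fun i _ => (if_pos (h i)).symm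
  · rw [if_neg fun h' => h (congrFun h')]
    push Not at h
    obtain ⟨i, hi⟩ := h
    exact (Finset.prod_eq_zero (Finset.mem_univ i) (if_neg hi)).symm

end MassEntropy

section Hull

theorem sum_eq_sum_embedding {ι κ F : Type*} [Fintype ι] [Fintype κ] [AddCommMonoid F]
    (e : ι ↪ κ) {φ : κ → F} (hφ : ∀ j, (¬∃ i, e i = j) → φ j = 0) : ∑ j, φ j = ∑ i, φ (e i) := by
  rw [← Finset.sum_map Finset.univ e φ]
  refine (Finset.sum_subset (Finset.subset_univ _) fun j _ hj => hφ j ?_).symm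
  simpa using hj

/-- In finite dimension the convex hull of a compact set is compact. -/
theorem isCompact_convexHull {E : Type*} [AddCommGroup E] [Module ℝ E]
    [TopologicalSpace E] [IsTopologicalAddGroup E] [ContinuousSMul ℝ E] [FiniteDimensional ℝ E]
    {s : Set E} (hs : IsCompact s) : IsCompact (convexHull ℝ s) := by
  classical
  rcases s.eq_empty_or_nonempty with rfl | ⟨z₀, hz₀⟩
  · simp
  set N := Module.finrank ℝ E + 1
  have himage : convexHull ℝ s = (fun t : (Fin N → ℝ) × (Fin N → E) => ∑ i, t.1 i • t.2 i) ''
      (stdSimplex ℝ (Fin N) ×ˢ Set.univ.pi fun _ => s) := by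
    ext x
    constructor
    · intro hx
      -- Carathéodory bounds the number of points by `N`; shorter combinations are padded with
      -- weight zero at `z₀`. The hull is then the continuous image of one compact set.
      obtain ⟨ι, _, z, w, hz, hind, hw, hw1, rfl⟩ := eq_pos_convex_span_of_mem_convexHull hx
      have hcard : Fintype.card ι ≤ Fintype.card (Fin N) := by
        rw [Fintype.card_fin]
        exact hind.card_le_finrank_succ.trans (Nat.succ_le_succ (Submodule.finrank_le _))
      obtain ⟨e⟩ := Function.Embedding.nonempty_of_card_le hcard
      refine ⟨(fun j => if h : ∃ i, e i = j then w h.choose else 0,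
        fun j => if h : ∃ i, e i = j then z h.choose else z₀), ⟨⟨fun j => ?_, ?_⟩, fun j _ => ?_⟩, ?_⟩
      · dsimp only
        split_ifs with h
        · exact (hw _).le
        · exact le_rfl
      · rw [← hw1]
        refine (sum_eq_sum_embedding e fun j hj => dif_neg hj).trans ?_
        refine Finset.sum_congr rfl fun i _ => ?_
        have h : ∃ i', e i' = e i := ⟨i, rfl⟩
        rw [dif_pos h, e.injective h.choose_spec]
      · dsimp only
        split_ifs with h
        · exact hz ⟨_, rfl⟩
        · exact hz₀
      · dsimp only
        refine (sum_eq_sum_embedding e fun j hj => ?_).trans ?_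
        · rw [dif_neg hj, zero_smul]
        refine Finset.sum_congr rfl fun i _ => ?_
        have h : ∃ i', e i' = e i := ⟨i, rfl⟩
        rw [dif_pos h, dif_pos h, e.injective h.choose_spec]
    · rintro ⟨⟨w, z⟩, ⟨hw, hz⟩, rfl⟩
      exact (convex_convexHull ℝ s).sum_mem (fun i _ => hw.1 i) hw.2
        fun i _ => subset_convexHull ℝ s (hz i (Set.mem_univ i))
  rw [himage]
  refine ((isCompact_stdSimplex _ _).prod (isCompact_univ_pi fun _ => hs)).image ?_
  fun_prop

end Hull

end FiniteEntropy

namespace BroadcastChannel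

open FiniteEntropy

/-! ### Information quantities as functions of the input law and of `H(Y|U)`. -/

section Formulas

variable {X Y₁ Y₂ A B Z : Type*} [Fintype Y₁] [Fintype Y₂] (W : BroadcastChannel X Y₁ Y₂) (g : Y₁ × Y₂ → Z)

/-- The transition probabilities of the channel whose output is the function `g` of the two
outputs. -/
noncomputable def output (x : X) : Z → ℝ := lawOf (W.prob x) g

theorem output_mem_stdSimplex [Fintype Z] (x : X) : W.output g x ∈ stdSimplex ℝ Z :=
  lawOf_mem_stdSimplex (W.prob_mem x) g

variable [Fintype X] [Fintype A]

open Classical in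
theorem lawOf_joint_pair {C : Type*} (p : A × X → ℝ) (h : A × X → C) (c : C) (z : Z) :
    lawOf (W.joint p) (fun ω => (h ω.1, g ω.2)) (c, z) =
      ∑ t, if h t = c then p t * W.output g t.2 z else 0 := by
  rw [lawOf_eq_sum_ite, Fintype.sum_prod_type]
  refine Finset.sum_congr rfl fun t _ => ?_
  simp only [Prod.mk.injEq, joint, output, lawOf_eq_sum_ite, Finset.mul_sum, mul_ite, mul_zero]
  by_cases h1 : h t = c
  · simp [h1]
  · simp [h1]

variable [Fintype B] [Fintype Z]

/-- The output entropy `H(g(Y₁, Y₂))` under the input mass function `r`. -/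
noncomputable def outEntropy (r : X → ℝ) : ℝ := massEntropy fun z => ∑ x, r x * W.output g x z

/-- The equivocation `H(g(Y₁, Y₂) | X)` under the input mass function `r`. -/
noncomputable def noiseEntropy (r : X → ℝ) : ℝ := ∑ x, r x * massEntropy (W.output g x)

/-- The conditional entropy `H(g(Y₁, Y₂) | A)`. -/
noncomputable def auxEntropy (p : A × X → ℝ) : ℝ :=
  entropy (W.joint p) (fun ω => (ω.1.1, g ω.2)) - entropy (W.joint p) fun ω => ω.1.1

theorem entropy_output (p : A × X → ℝ) :
    entropy (W.joint p) (fun ω => g ω.2) = W.outEntropy g (lawOf p Prod.snd) := by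
  classical
  rw [entropy_eq_massEntropy, outEntropy]
  congr 1
  ext z
  rw [sum_lawOf_mul p Prod.snd fun x => W.output g x z]
  have h1 : lawOf (W.joint p) (fun ω => g ω.2) z =
      lawOf (W.joint p) (fun ω => ((), g ω.2)) ((), z) := by
    rw [lawOf_eq_sum_ite, lawOf_eq_sum_ite]
    simp
  rw [h1, lawOf_joint_pair W g p fun _ => ()]
  simp

/-- The Markov property: once the conditioning variable determines `X`, further knowledge of the
auxiliary is irrelevant to the output. It serves for conditioning on `X` and on `(b A, X)`. -/
theorem entropy_pair_sub_eq_noiseEntropy {C : Type*} [Fintype C] (p : A × X → ℝ)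
    (h : A × X → C) (ξ : C → X) (hξ : ∀ t, ξ (h t) = t.2) :
    entropy (W.joint p) (fun ω => (h ω.1, g ω.2)) - entropy (W.joint p) (fun ω => h ω.1) =
      W.noiseEntropy g (lawOf p Prod.snd) := by
  classical
  rw [entropy_pair_sub (P := W.joint p) (fun ω => h ω.1) (fun ω => g ω.2)
    (κ := fun c => W.output g (ξ c)) (fun c => (W.output_mem_stdSimplex g _).2)]
  · rw [lawOf_joint, sum_lawOf_mul p h fun c => massEntropy (W.output g (ξ c)), noiseEntropy,
      sum_lawOf_mul p Prod.snd fun x => massEntropy (W.output g x)]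
    simp only [hξ]
  · intro c z
    rw [lawOf_joint_pair, lawOf_joint, lawOf_eq_sum_ite, Finset.sum_mul]
    refine Finset.sum_congr rfl fun t _ => ?_
    split_ifs with ht
    · rw [← ht, hξ]
    · rw [zero_mul]

theorem auxEntropy_eq_sum {p : A × X → ℝ} {m : A → ℝ} {ρ : A → X → ℝ}
    (hρ : ∀ a, ρ a ∈ stdSimplex ℝ X) (h : ∀ a x, p (a, x) = m a * ρ a x) :
    W.auxEntropy g p = ∑ a, m a * W.outEntropy g (ρ a) := by
  classical
  have hm : lawOf p Prod.fst = m := by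
    ext a
    simp only [lawOf_fst, h, ← Finset.mul_sum, (hρ a).2, mul_one]
  have hm' : lawOf (W.joint p) (fun ω => ω.1.1) = m := by rw [W.lawOf_joint p Prod.fst, hm]
  rw [auxEntropy, entropy_pair_sub (P := W.joint p) (fun ω => ω.1.1) (fun ω => g ω.2)
    (κ := fun a z => ∑ x, ρ a x * W.output g x z), hm']
  · rfl
  · intro a
    rw [Finset.sum_comm]
    simp only [← Finset.mul_sum, (W.output_mem_stdSimplex g _).2, mul_one, (hρ a).2]
  · intro a z
    rw [hm', lawOf_joint_pair W g p Prod.fst, Fintype.sum_prod_type, Finset.sum_eq_single a]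
    · simp only [if_true, h, mul_assoc, ← Finset.mul_sum]
    · intro a' _ ha
      simp [ha]
    · simp

/-- In this and the next two formulas the auxiliary enters only through `auxEntropy`. The rest
depends on the input law, continuously, so a point of `entropyHull` determines every bound of the
converse. -/
theorem mutualInfo_aux (p : A × X → ℝ) (b : A → B) :
    mutualInfo (W.joint p) (fun ω => b ω.1.1) (fun ω => g ω.2) =
      W.outEntropy g (lawOf p Prod.snd) - W.auxEntropy g (mapAux p b) := by
  rw [auxEntropy, joint_mapAux, entropy_lawOf, entropy_lawOf, mutualInfo, entropy_output]
  ring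

theorem mutualInfo_input (p : A × X → ℝ) :
    mutualInfo (W.joint p) (fun ω => ω.1.2) (fun ω => g ω.2) =
      W.outEntropy g (lawOf p Prod.snd) - W.noiseEntropy g (lawOf p Prod.snd) := by
  rw [← W.entropy_pair_sub_eq_noiseEntropy g p Prod.snd id fun _ => rfl, mutualInfo,
    entropy_output]
  ring

theorem condMutualInfo_aux (p : A × X → ℝ) (b : A → B) :
    condMutualInfo (W.joint p) (fun ω => ω.1.2) (fun ω => g ω.2) (fun ω => b ω.1.1) =
      W.auxEntropy g (mapAux p b) - W.noiseEntropy g (lawOf p Prod.snd) := by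
  rw [← W.entropy_pair_sub_eq_noiseEntropy g p (fun t => (b t.1, t.2)) Prod.snd fun _ => rfl,
    auxEntropy, joint_mapAux, entropy_lawOf, entropy_lawOf, condMutualInfo,
    entropy_congr _ (f := fun ω : (A × X) × Y₁ × Y₂ => (ω.1.2, b ω.1.1))
      (g := fun ω => (b ω.1.1, ω.1.2)) (by simp; tauto),
    entropy_congr _ (f := fun ω : (A × X) × Y₁ × Y₂ => (g ω.2, b ω.1.1))
      (g := fun ω => (b ω.1.1, g ω.2)) (by simp; tauto),
    entropy_congr _ (f := fun ω : (A × X) × Y₁ × Y₂ => (ω.1.2, g ω.2, b ω.1.1))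
      (g := fun ω => ((b ω.1.1, ω.1.2), g ω.2)) (by simp; tauto)]
  ring

theorem continuous_outEntropy : Continuous (W.outEntropy g) :=
  continuous_massEntropy.comp (by fun_prop)

theorem continuous_noiseEntropy : Continuous (W.noiseEntropy g) := by
  unfold noiseEntropy
  fun_prop

/-- The output law is linear in the input law, so concavity of entropy carries over; for
`noiseEntropy` below there is equality. -/
theorem sum_mul_outEntropy_le {ι : Type*} {s : Finset ι} {w : ι → ℝ} (hw : ∀ i ∈ s, 0 ≤ w i)
    (hw1 : ∑ i ∈ s, w i = 1) {r : ι → X → ℝ} (hr : ∀ i ∈ s, ∀ x, 0 ≤ r i x) :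
    ∑ i ∈ s, w i * W.outEntropy g (r i) ≤ W.outEntropy g (∑ i ∈ s, w i • r i) := by
  refine (sum_mul_massEntropy_le hw hw1 fun i hi z => Finset.sum_nonneg fun x _ =>
    mul_nonneg (hr i hi x) ((W.output_mem_stdSimplex g x).1 z)).trans_eq ?_
  rw [outEntropy]
  congr 1
  ext z
  simp only [Finset.sum_apply, Pi.smul_apply, smul_eq_mul, Finset.sum_mul, Finset.mul_sum]
  rw [Finset.sum_comm]
  exact Finset.sum_congr rfl fun _ _ => Finset.sum_congr rfl fun _ _ => by ring

theorem sum_mul_noiseEntropy {ι : Type*} (s : Finset ι) (w : ι → ℝ) (r : ι → X → ℝ) :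
    ∑ i ∈ s, w i * W.noiseEntropy g (r i) = W.noiseEntropy g (∑ i ∈ s, w i • r i) := by
  simp only [noiseEntropy, Finset.sum_apply, Pi.smul_apply, smul_eq_mul, Finset.sum_mul,
    Finset.mul_sum]
  rw [Finset.sum_comm]
  exact Finset.sum_congr rfl fun _ _ => Finset.sum_congr rfl fun _ _ => by ring

end Formulas

/-! ### The compact convex set of triples `(p(x), H(Y₁|U), H(Y₂|U))`. -/

section Hull

variable {X Y₁ Y₂ A : Type*} [Fintype X] [Fintype Y₁] [Fintype Y₂] [Fintype A]
  (W : BroadcastChannel X Y₁ Y₂)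

/-- The triples `(p(x), H(Y₁ | U), H(Y₂ | U))` for finitely valued `U` form the convex hull of
those with `U` constant. -/
def entropyHull : Set ((X → ℝ) × ℝ × ℝ) :=
  convexHull ℝ ((fun r => (r, W.outEntropy Prod.fst r, W.outEntropy Prod.snd r)) '' stdSimplex ℝ X)

/-- This plays the role of a bound on the cardinality of the auxiliary alphabet. -/
theorem isCompact_entropyHull : IsCompact W.entropyHull :=
  isCompact_convexHull ((isCompact_stdSimplex _ _).image (continuous_id.prodMk
    ((W.continuous_outEntropy _).prodMk (W.continuous_outEntropy _))))

/-- Values of `U` are the points of a convex combination: weights `P(U = a)`, points the conditional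
laws of `X`. The next lemma reads the same dictionary backwards. -/
theorem auxEntropy_mem_entropyHull {p : A × X → ℝ} (hp : p ∈ stdSimplex ℝ (A × X)) :
    (lawOf p Prod.snd, W.auxEntropy Prod.fst p, W.auxEntropy Prod.snd p) ∈ W.entropyHull := by
  have hρ := condKernel_mem_stdSimplex hp
  have h := fun a x => (lawOf_fst_mul_condKernel hp.1 a x).symm
  have hm : lawOf p Prod.fst ∈ stdSimplex ℝ A := lawOf_mem_stdSimplex hp _
  refine mem_convexHull_of_exists_fintype (lawOf p Prod.fst)
    (fun a => (condKernel p a, W.outEntropy Prod.fst (condKernel p a),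
      W.outEntropy Prod.snd (condKernel p a))) hm.1 hm.2 (fun a => ⟨_, hρ a, rfl⟩) ?_
  rw [W.auxEntropy_eq_sum _ hρ h, W.auxEntropy_eq_sum _ hρ h]
  refine Prod.ext ?_ (Prod.ext ?_ ?_)
  · ext x
    simp only [Prod.fst_sum, Prod.smul_fst, Finset.sum_apply, Pi.smul_apply, smul_eq_mul, lawOf_snd]
    exact Finset.sum_congr rfl fun a _ => (h a x).symm
  · simp [Prod.snd_sum, Prod.fst_sum]
  · simp [Prod.snd_sum]

theorem exists_of_mem_entropyHull {z : (X → ℝ) × ℝ × ℝ} (hz : z ∈ W.entropyHull) :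
    ∃ (k : ℕ) (p : Fin k × X → ℝ), p ∈ stdSimplex ℝ (Fin k × X) ∧ lawOf p Prod.snd = z.1 ∧
      W.auxEntropy Prod.fst p = z.2.1 ∧ W.auxEntropy Prod.snd p = z.2.2 := by
  obtain ⟨ι, _, w, t, hw, hw1, ht, rfl⟩ := mem_convexHull_iff_exists_fintype.1 hz
  choose r hr hrt using ht
  let e := (Fintype.equivFin ι).symm
  have hp : ∀ a x, (fun s : Fin (Fintype.card ι) × X => w (e s.1) * r (e s.1) s.2) (a, x) =
      w (e a) * r (e a) x := fun _ _ => rfl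
  refine ⟨Fintype.card ι, fun s => w (e s.1) * r (e s.1) s.2,
    ⟨fun s => mul_nonneg (hw _) ((hr _).1 _), ?_⟩, ?_, ?_, ?_⟩
  · rw [Fintype.sum_prod_type]
    simp only [← Finset.mul_sum, (hr _).2, mul_one]
    rw [e.sum_comp w, hw1]
  · ext x
    rw [lawOf_snd, e.sum_comp fun i => w i * r i x]
    simp [Prod.fst_sum, ← hrt]
  · rw [W.auxEntropy_eq_sum _ (fun a => hr (e a)) hp,
      e.sum_comp fun i => w i * W.outEntropy Prod.fst (r i)]
    simp [Prod.fst_sum, Prod.snd_sum, ← hrt]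
  · rw [W.auxEntropy_eq_sum _ (fun a => hr (e a)) hp,
      e.sum_comp fun i => w i * W.outEntropy Prod.snd (r i)]
    simp [Prod.snd_sum, ← hrt]

end Hull

end BroadcastChannel

namespace FiniteEntropy

/-! ### Chain rules and the Csiszár sum identity. -/

section Chains

variable {Ω B Y Z : Type*} {n : ℕ}

/-- The variables `y j` with `j < i` and `z j` with `j > i`. -/
def splitAt (y : Ω → Fin n → Y) (z : Ω → Fin n → Z) (i : Fin n) (ω : Ω) (j : Fin n) :
    Option (Y ⊕ Z) :=
  if j < i then some (Sum.inl (y ω j)) else if i < j then some (Sum.inr (z ω j)) else none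

/-- The variables `y j` with `j < i` and `z j` with `j ≥ i`. -/
def hybrid (y : Ω → Fin n → Y) (z : Ω → Fin n → Z) (i : ℕ) (ω : Ω) (j : Fin n) : Y ⊕ Z :=
  if (j : ℕ) < i then Sum.inl (y ω j) else Sum.inr (z ω j)

/-- The variables `z j` with `j ≥ i`. -/
def tail (z : Ω → Fin n → Z) (i : ℕ) (ω : Ω) (j : Fin n) : Option Z :=
  if i ≤ (j : ℕ) then some (z ω j) else none

theorem splitAt_eq_iff (y : Ω → Fin n → Y) (z : Ω → Fin n → Z) (i : Fin n) (ω ω' : Ω) :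
    splitAt y z i ω = splitAt y z i ω' ↔
      (∀ j < i, y ω j = y ω' j) ∧ ∀ j, i < j → z ω j = z ω' j := by
  simp only [funext_iff, splitAt]
  constructor
  · intro h
    refine ⟨fun j hj => ?_, fun j hj => ?_⟩
    · simpa [hj] using h j
    · simpa [hj, hj.not_gt] using h j
  · rintro ⟨h1, h2⟩ j
    rcases lt_trichotomy j i with hj | rfl | hj
    · simp [hj, h1 j hj]
    · simp
    · simp [hj, hj.not_gt, h2 j hj]

theorem hybrid_eq_iff (y : Ω → Fin n → Y) (z : Ω → Fin n → Z) (i : ℕ) (ω ω' : Ω) :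
    hybrid y z i ω = hybrid y z i ω' ↔
      (∀ j : Fin n, (j : ℕ) < i → y ω j = y ω' j) ∧
        ∀ j : Fin n, i ≤ (j : ℕ) → z ω j = z ω' j := by
  simp only [funext_iff, hybrid]
  constructor
  · intro h
    refine ⟨fun j hj => ?_, fun j hj => ?_⟩
    · simpa [hj] using h j
    · simpa [hj.not_gt] using h j
  · rintro ⟨h1, h2⟩ j
    rcases lt_or_ge (j : ℕ) i with hj | hj
    · simp [hj, h1 j hj]
    · simp [hj.not_gt, h2 j hj]

theorem tail_eq_iff (z : Ω → Fin n → Z) (i : ℕ) (ω ω' : Ω) :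
    tail z i ω = tail z i ω' ↔ ∀ j : Fin n, i ≤ (j : ℕ) → z ω j = z ω' j := by
  simp only [funext_iff, tail]
  refine forall_congr' fun j => ?_
  by_cases hj : i ≤ (j : ℕ) <;> simp [hj]

theorem sum_sub_succ (f : ℕ → ℝ) : ∑ i : Fin n, (f i - f (i + 1)) = f 0 - f n := by
  rw [Fin.sum_univ_eq_sum_range fun i => f i - f (i + 1)]
  exact Finset.sum_range_sub' f n

variable [Fintype Ω] [Fintype B] [Fintype Y] [Fintype Z]

/-- The Csiszár sum identity. -/
theorem csiszar_sum (P : Ω → ℝ) (w : Ω → B) (y : Ω → Fin n → Y) (z : Ω → Fin n → Z) :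
    ∑ i, (entropy P (fun ω => ((w ω, splitAt y z i ω), y ω i)) -
      entropy P (fun ω => ((w ω, splitAt y z i ω), z ω i))) =
      entropy P (fun ω => (w ω, y ω)) - entropy P (fun ω => (w ω, z ω)) := by
  -- Inserting `y i` into the gap of `splitAt` gives the hybrid sequence of index `i + 1`, inserting
  -- `z i` that of index `i`; the sum telescopes.
  have h1 : ∀ i : Fin n, entropy P (fun ω => ((w ω, splitAt y z i ω), y ω i)) =
      entropy P (fun ω => (w ω, hybrid y z (i + 1) ω)) := by
    intro i
    refine entropy_congr P fun ω ω' => ?_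
    simp only [Prod.mk.injEq, splitAt_eq_iff, hybrid_eq_iff]
    constructor
    · rintro ⟨⟨hw, h1, h2⟩, h3⟩
      refine ⟨hw, fun j hj => ?_, fun j hj => h2 j hj⟩
      rcases (Nat.lt_succ_iff.1 hj).lt_or_eq with h | h
      · exact h1 j h
      · rw [Fin.ext h]
        exact h3
    · rintro ⟨hw, h1, h2⟩
      exact ⟨⟨hw, fun j hj => h1 j (Nat.lt_succ_of_lt hj), fun j hj => h2 j hj⟩,
        h1 i (Nat.lt_succ_self _)⟩
  have h2 : ∀ i : Fin n, entropy P (fun ω => ((w ω, splitAt y z i ω), z ω i)) =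
      entropy P (fun ω => (w ω, hybrid y z i ω)) := by
    intro i
    refine entropy_congr P fun ω ω' => ?_
    simp only [Prod.mk.injEq, splitAt_eq_iff, hybrid_eq_iff]
    constructor
    · rintro ⟨⟨hw, h1, h2⟩, h3⟩
      refine ⟨hw, fun j hj => h1 j hj, fun j hj => ?_⟩
      rcases hj.lt_or_eq with h | h
      · exact h2 j h
      · rw [← Fin.ext h]
        exact h3
    · rintro ⟨hw, h1, h2⟩
      exact ⟨⟨hw, fun j hj => h1 j hj, fun j hj => h2 j (le_of_lt hj)⟩, h2 i le_rfl⟩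
  have h3 : entropy P (fun ω => (w ω, hybrid y z 0 ω)) = entropy P (fun ω => (w ω, z ω)) :=
    entropy_congr P fun ω ω' => by simp [hybrid_eq_iff, funext_iff (f := z ω)]
  have h4 : entropy P (fun ω => (w ω, hybrid y z n ω)) = entropy P (fun ω => (w ω, y ω)) :=
    entropy_congr P fun ω ω' => by
      simp only [Prod.mk.injEq, hybrid_eq_iff, funext_iff (f := y ω), Fin.is_lt, forall_const]
      refine and_congr_right fun _ => and_iff_left fun j hj => absurd j.2 hj.not_gt
  simp only [h1, h2]
  rw [← h3, ← h4, ← neg_inj, ← Finset.sum_neg_distrib, neg_sub,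
    ← sum_sub_succ fun i => entropy P (fun ω => (w ω, hybrid y z i ω))]
  simp only [neg_sub]

/-- Conditioning on more variables only reduces the terms of the chain rule. -/
theorem sum_splitAt_le {P : Ω → ℝ} (hP : P ∈ stdSimplex ℝ Ω) (w : Ω → B) (y : Ω → Fin n → Y)
    (z : Ω → Fin n → Z) :
    ∑ i, (entropy P (fun ω => ((w ω, splitAt y z i ω), z ω i)) -
      entropy P (fun ω => (w ω, splitAt y z i ω))) ≤
      entropy P (fun ω => (w ω, z ω)) - entropy P w := by
  have h3 : entropy P (fun ω => (w ω, tail z 0 ω)) = entropy P (fun ω => (w ω, z ω)) :=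
    entropy_congr P fun ω ω' => by simp [tail_eq_iff, funext_iff (f := z ω)]
  have h4 : entropy P (fun ω => (w ω, tail z n ω)) = entropy P w :=
    entropy_congr P fun ω ω' => by
      simp only [Prod.mk.injEq, tail_eq_iff]
      exact and_iff_left fun j hj => absurd j.2 hj.not_gt
  rw [← h3, ← h4, ← sum_sub_succ fun i => entropy P (fun ω => (w ω, tail z i ω))]
  refine Finset.sum_le_sum fun i _ => ?_
  -- The chain rule for `z` runs from the last coordinate backwards; submodularity adds the earlier
  -- `y j` to the condition.
  have h := entropy_submodular hP (fun ω => z ω i)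
    (fun ω (j : Fin n) => if j < i then some (y ω j) else none)
    (fun ω => (w ω, tail z (i + 1) ω))
  have hy : ∀ ω ω', ((fun j : Fin n => if j < i then some (y ω j) else none) =
      fun j : Fin n => if j < i then some (y ω' j) else none) ↔ ∀ j < i, y ω j = y ω' j := by
    intro ω ω'
    rw [funext_iff]
    refine forall_congr' fun j => ?_
    by_cases hj : j < i <;> simp [hj]
  have e1 : entropy P (fun ω => (z ω i, (fun j : Fin n => if j < i then some (y ω j) else none),
      w ω, tail z (i + 1) ω)) = entropy P (fun ω => ((w ω, splitAt y z i ω), z ω i)) :=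
    entropy_congr P fun ω ω' => by
      simp only [Prod.mk.injEq, splitAt_eq_iff, tail_eq_iff, hy, Nat.succ_le_iff, Fin.val_fin_lt]
      tauto
  have e2 : entropy P (fun ω => ((fun j : Fin n => if j < i then some (y ω j) else none),
      w ω, tail z (i + 1) ω)) = entropy P (fun ω => (w ω, splitAt y z i ω)) :=
    entropy_congr P fun ω ω' => by
      simp only [Prod.mk.injEq, splitAt_eq_iff, tail_eq_iff, hy, Nat.succ_le_iff, Fin.val_fin_lt]
      tauto
  have e3 : entropy P (fun ω => (z ω i, w ω, tail z (i + 1) ω)) =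
      entropy P (fun ω => (w ω, tail z i ω)) :=
    entropy_congr P fun ω ω' => by
      simp only [Prod.mk.injEq, tail_eq_iff, Nat.succ_le_iff]
      constructor
      · rintro ⟨h1, hw, h2⟩
        refine ⟨hw, fun j hj => ?_⟩
        rcases hj.lt_or_eq with h | h
        · exact h2 j h
        · rw [← Fin.ext h]
          exact h1
      · rintro ⟨hw, h2⟩
        exact ⟨h2 i le_rfl, hw, fun j hj => h2 j hj.le⟩
  rw [e1, e2, e3] at h
  linarith

theorem entropy_seq_le {P : Ω → ℝ} (hP : P ∈ stdSimplex ℝ Ω) (z : Ω → Fin n → Z) :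
    entropy P z ≤ ∑ i, entropy P (fun ω => z ω i) := by
  have h3 : entropy P (tail z 0) = entropy P z :=
    entropy_congr P fun ω ω' => by simp [tail_eq_iff, funext_iff (f := z ω)]
  have h4 : entropy P (tail z n) = 0 := by
    rw [← entropy_of_subsingleton hP fun _ => ()]
    refine entropy_congr P fun ω ω' => ?_
    simp only [tail_eq_iff, iff_true]
    exact fun j hj => absurd j.2 hj.not_gt
  rw [← h3, ← sub_zero (entropy P _), ← h4, ← sum_sub_succ fun i => entropy P (tail z i)]
  refine Finset.sum_le_sum fun i _ => ?_
  have h := entropy_subadditive hP (fun ω => z ω i) (tail z (i + 1))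
  have e : entropy P (fun ω => (z ω i, tail z (i + 1) ω)) = entropy P (tail z i) :=
    entropy_congr P fun ω ω' => by
      simp only [Prod.mk.injEq, tail_eq_iff, Nat.succ_le_iff]
      constructor
      · rintro ⟨h1, h2⟩ j hj
        rcases hj.lt_or_eq with h | h
        · exact h2 j h
        · rw [← Fin.ext h]
          exact h1
      · intro h2
        exact ⟨h2 i le_rfl, fun j hj => h2 j hj.le⟩
  linarith

end Chains

end FiniteEntropy

namespace BroadcastChannel

open FiniteEntropy

/-! ### The law of messages and outputs induced by a code. -/

section Block

variable {X Y₁ Y₂ M B : Type*} [Fintype Y₁] [Fintype Y₂] {n : ℕ}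
  (W : BroadcastChannel X Y₁ Y₂)

/-- The joint mass function of the message and the `n` channel outputs. -/
def blockMass (μ : M → ℝ) (enc : M → Fin n → X) (ω : M × (Fin n → Y₁ × Y₂)) : ℝ :=
  μ ω.1 * piMass (fun i => W.prob (enc ω.1 i)) ω.2

variable [Fintype M] {μ : M → ℝ} (enc : M → Fin n → X)

theorem blockMass_mem_stdSimplex (hμ : μ ∈ stdSimplex ℝ M) :
    W.blockMass μ enc ∈ stdSimplex ℝ (M × (Fin n → Y₁ × Y₂)) := by
  refine ⟨fun ω => mul_nonneg (hμ.1 _) (piMass_nonneg (fun i => (W.prob_mem _).1) _), ?_⟩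
  rw [Fintype.sum_prod_type]
  simp only [blockMass, ← Finset.mul_sum, sum_piMass fun i => (W.prob_mem _).2, mul_one, hμ.2]

theorem lawOf_blockMass_fst : lawOf (W.blockMass μ enc) Prod.fst = μ := by
  ext m
  simp only [lawOf_fst, blockMass, ← Finset.mul_sum, sum_piMass fun i => (W.prob_mem _).2, mul_one]

/-- Given the message the outputs are independent, each depending on its own input letter, so the
equivocation is a sum over time. -/
theorem entropy_block_sub {Z : Type*} [Fintype X] [Fintype Z] (g : Y₁ × Y₂ → Z) :
    entropy (W.blockMass μ enc) (fun ω => (ω.1, fun i => g (ω.2 i))) -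
        entropy (W.blockMass μ enc) Prod.fst =
      ∑ i, W.noiseEntropy g (lawOf (W.blockMass μ enc) fun ω => enc ω.1 i) := by
  classical
  rw [entropy_pair_sub (P := W.blockMass μ enc) Prod.fst (fun ω i => g (ω.2 i))
    (κ := fun m => piMass fun i => W.output g (enc m i))
    (fun m => sum_piMass fun i => (W.output_mem_stdSimplex g _).2)]
  · rw [sum_lawOf_mul _ Prod.fst fun m => massEntropy (piMass fun i => W.output g (enc m i))]
    simp only [massEntropy_piMass fun i => W.output_mem_stdSimplex g _, Finset.mul_sum]
    rw [Finset.sum_comm]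
    refine Finset.sum_congr rfl fun i _ => ?_
    rw [noiseEntropy, sum_lawOf_mul _ (fun ω : M × (Fin n → Y₁ × Y₂) => enc ω.1 i)
      fun x => massEntropy (W.output g x)]
  · intro m z
    rw [lawOf_blockMass_fst, show (fun i => W.output g (enc m i)) =
      fun i => lawOf (W.prob (enc m i)) g from rfl, ← lawOf_piMass, lawOf_eq_sum_ite,
      lawOf_eq_sum_ite, Fintype.sum_prod_type, Finset.sum_eq_single m]
    · simp only [Prod.mk.injEq, true_and, Finset.mul_sum, mul_ite, mul_zero]
      rfl
    · intro m' _ hm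
      exact Finset.sum_eq_zero fun y _ => if_neg fun h => hm (Prod.ext_iff.1 h).1
    · simp

/-- A variable that does not involve the outputs at time `i` is independent of them given the
input at time `i`. -/
theorem lawOf_block_markov (i : Fin n) {U : M × (Fin n → Y₁ × Y₂) → B}
    (hU : ∀ m y b, U (m, Function.update y i b) = U (m, y)) :
    lawOf (W.blockMass μ enc) (fun ω => ((U ω, enc ω.1 i), ω.2 i)) =
      W.joint (lawOf (W.blockMass μ enc) fun ω => (U ω, enc ω.1 i)) := by
  classical
  ext ⟨⟨u, x⟩, b⟩
  simp only [joint]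
  rw [lawOf_eq_sum_ite, lawOf_eq_sum_ite, Fintype.sum_prod_type, Fintype.sum_prod_type,
    Finset.sum_mul]
  refine Finset.sum_congr rfl fun m _ => ?_
  -- The output at time `i` is drawn afresh, which leaves `U` and the input unchanged.
  have h := sum_piMass_resample (fun i => W.prob (enc m i)) i (W.prob_mem _).2
    fun y => if ((U (m, y), enc m i), y i) = ((u, x), b) then μ m else 0
  simp only [hU, Function.update_self] at h
  calc _ = ∑ y, piMass (fun i => W.prob (enc m i)) y *
          (if ((U (m, y), enc m i), y i) = ((u, x), b) then μ m else 0) := by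
        refine Finset.sum_congr rfl fun y _ => ?_
        by_cases hc : ((U (m, y), enc m i), y i) = ((u, x), b)
        · rw [if_pos hc, if_pos hc, blockMass, mul_comm]
        · rw [if_neg hc, if_neg hc, mul_zero]
    _ = _ := by
        rw [h, Finset.sum_mul]
        refine Finset.sum_congr rfl fun y _ => ?_
        by_cases hu : (U (m, y), enc m i) = (u, x)
        · have hx : enc m i = x := (Prod.ext_iff.1 hu).2
          rw [if_pos hu, Finset.sum_eq_single b]
          · rw [if_pos (by rw [hu]), blockMass, ← hx]
            ring
          · intro b' _ hb
            rw [if_neg fun h => hb (Prod.ext_iff.1 h).2, mul_zero]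
          · simp
        · rw [if_neg hu, zero_mul]
          refine mul_eq_zero_of_right _ (Finset.sum_eq_zero fun b' _ => ?_)
          rw [if_neg fun h => hu (Prod.ext_iff.1 h).1, mul_zero]

variable [Fintype X] [Fintype B]

theorem entropy_block_output {Z : Type*} [Fintype Z] (g : Y₁ × Y₂ → Z) (i : Fin n) :
    entropy (W.blockMass μ enc) (fun ω => g (ω.2 i)) =
      W.outEntropy g (lawOf (W.blockMass μ enc) fun ω => enc ω.1 i) := by
  have h := W.entropy_output g (lawOf (W.blockMass μ enc) fun ω => ((), enc ω.1 i))
  rw [← W.lawOf_block_markov enc i (U := fun _ => ()) fun _ _ _ => rfl, entropy_lawOf,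
    lawOf_lawOf] at h
  exact h

theorem block_mem_entropyHull (hμ : μ ∈ stdSimplex ℝ M) (i : Fin n)
    {U : M × (Fin n → Y₁ × Y₂) → B} (hU : ∀ m y b, U (m, Function.update y i b) = U (m, y)) :
    (lawOf (W.blockMass μ enc) fun ω => enc ω.1 i,
      entropy (W.blockMass μ enc) (fun ω => (U ω, (ω.2 i).1)) - entropy (W.blockMass μ enc) U,
      entropy (W.blockMass μ enc) (fun ω => (U ω, (ω.2 i).2)) - entropy (W.blockMass μ enc) U) ∈
      W.entropyHull := by
  have h := W.auxEntropy_mem_entropyHull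
    (lawOf_mem_stdSimplex (W.blockMass_mem_stdSimplex enc hμ) fun ω => (U ω, enc ω.1 i))
  simp only [auxEntropy, ← W.lawOf_block_markov enc i hU, entropy_lawOf, lawOf_lawOf] at h
  exact h

end Block

end BroadcastChannel

namespace BroadcastChannel

open FiniteEntropy

/-! ### The single-letter outer bound for one code. -/

section Converse

variable {X Y₁ Y₂ : Type*}

/-- Coordinate `i` is left out of `splitAt`; this makes `Uᵢ` and `Vᵢ` admissible in
`lawOf_block_markov`. -/
theorem splitAt_update {M : Type*} {n : ℕ} (i : Fin n) (m : M) (y : Fin n → Y₁ × Y₂)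
    (b : Y₁ × Y₂) :
    splitAt (fun (ω : M × (Fin n → Y₁ × Y₂)) j => (ω.2 j).1) (fun ω j => (ω.2 j).2) i
        (m, Function.update y i b) =
      splitAt (fun (ω : M × (Fin n → Y₁ × Y₂)) j => (ω.2 j).1) (fun ω j => (ω.2 j).2) i
        (m, y) := by
  rw [splitAt_eq_iff]
  exact ⟨fun j hj => by simp [hj.ne], fun j hj => by simp [hj.ne']⟩

variable [Fintype Y₁] [Fintype Y₂] (W : BroadcastChannel X Y₁ Y₂)

open Classical in
theorem errorProb_eq_sum_blockMass {M₁ M₂ n : ℕ} (c : BroadcastCode X Y₁ Y₂ M₁ M₂ n) :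
    W.errorProb c = ∑ ω : (Fin M₁ × Fin M₂) × (Fin n → Y₁ × Y₂),
      if c.decoder₁ (fun i => (ω.2 i).1) ≠ ω.1.1 ∨ c.decoder₂ (fun i => (ω.2 i).2) ≠ ω.1.2 then
        W.blockMass (fun _ => 1 / ((M₁ : ℝ) * M₂)) (fun m => c.encoder m.1 m.2) ω else 0 := by
  rw [errorProb, Fintype.sum_prod_type, Fintype.sum_prod_type]
  simp only [Finset.mul_sum]
  refine Finset.sum_congr rfl fun _ _ => Finset.sum_congr rfl fun _ _ =>
    Finset.sum_congr rfl fun y _ => ?_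
  split_ifs
  · rfl
  · exact mul_zero _

variable [Fintype X]

/-- The average over time of points of the entropy hull. -/
theorem exists_average {n : ℕ} (hn : 0 < n) {r : Fin n → X → ℝ} {a b : Fin n → ℝ} (h : ∀ i, (r i, a i, b i) ∈ W.entropyHull) :
    ∃ z ∈ W.entropyHull, z.1 = ∑ i, (1 / (n : ℝ)) • r i ∧ n * z.2.1 = ∑ i, a i ∧
      n * z.2.2 = ∑ i, b i := by
  have hn' : (n : ℝ) ≠ 0 := by exact_mod_cast hn.ne'
  -- By convexity, a uniform time-sharing variable is absorbed into the auxiliary.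
  refine ⟨∑ i, (1 / (n : ℝ)) • (r i, a i, b i),
    (convex_convexHull ℝ _).sum_mem (fun _ _ => by positivity) ?_ fun i _ => h i, ?_, ?_, ?_⟩
  · simp [hn']
  · simp [Prod.fst_sum]
  · simp [Prod.fst_sum, Prod.snd_sum, ← Finset.mul_sum, hn']
  · simp [Prod.snd_sum, ← Finset.mul_sum, hn']

theorem sum_outEntropy_le {Z : Type*} [Fintype Z] (g : Y₁ × Y₂ → Z) {n : ℕ} (hn : 0 < n)
    {r : Fin n → X → ℝ} (hr : ∀ i x, 0 ≤ r i x) :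
    ∑ i, W.outEntropy g (r i) ≤ n * W.outEntropy g (∑ i, (1 / (n : ℝ)) • r i) := by
  have hn' : (0 : ℝ) < n := by exact_mod_cast hn
  have h := W.sum_mul_outEntropy_le g (s := Finset.univ) (w := fun _ : Fin n => 1 / (n : ℝ))
    (fun _ _ => by positivity) (by simp [hn'.ne']) fun i _ => hr i
  rw [← Finset.mul_sum, one_div, inv_mul_le_iff₀ hn'] at h
  simpa only [one_div] using h

theorem sum_noiseEntropy_eq {Z : Type*} [Fintype Z] (g : Y₁ × Y₂ → Z) {n : ℕ} (hn : 0 < n)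
    (r : Fin n → X → ℝ) :
    ∑ i, W.noiseEntropy g (r i) = n * W.noiseEntropy g (∑ i, (1 / (n : ℝ)) • r i) := by
  have hn' : (n : ℝ) ≠ 0 := by exact_mod_cast hn.ne'
  rw [← W.sum_mul_noiseEntropy g, ← Finset.mul_sum]
  field_simp

/-- The single-letter outer bound satisfied by every code, up to Fano's terms. -/
theorem exists_entropyHull_of_code {M₁ M₂ n : ℕ} (hM₁ : 0 < M₁) (hM₂ : 0 < M₂) (hn : 0 < n)
    (c : BroadcastCode X Y₁ Y₂ M₁ M₂ n) :
    ∃ z ∈ W.entropyHull, ∃ z' ∈ W.entropyHull, z.1 = z'.1 ∧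
      Real.logb 2 M₂ - (1 + W.errorProb c * Real.logb 2 M₂) ≤
        n * (W.outEntropy Prod.snd z.1 - z.2.2) ∧
      Real.logb 2 M₁ + Real.logb 2 M₂ -
          (2 + W.errorProb c * (Real.logb 2 M₁ + Real.logb 2 M₂)) ≤
        n * (W.outEntropy Prod.snd z.1 - z.2.2 + z.2.1 - W.noiseEntropy Prod.fst z.1) ∧
      Real.logb 2 M₁ + Real.logb 2 M₂ -
          (2 + W.errorProb c * (Real.logb 2 M₁ + Real.logb 2 M₂)) ≤
        n * (W.outEntropy Prod.fst z.1 - z'.2.1 + z'.2.2 - W.noiseEntropy Prod.snd z.1) := by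
  classical
  have : NeZero M₁ := ⟨hM₁.ne'⟩
  have : NeZero M₂ := ⟨hM₂.ne'⟩
  have hM₁' : (0 : ℝ) < M₁ := by exact_mod_cast hM₁
  have hM₂' : (0 : ℝ) < M₂ := by exact_mod_cast hM₂
  have hn' : (0 : ℝ) < n := by exact_mod_cast hn
  obtain ⟨μ, hμdef⟩ : ∃ μ : Fin M₁ × Fin M₂ → ℝ, μ = fun _ => 1 / ((M₁ : ℝ) * M₂) := ⟨_, rfl⟩
  obtain ⟨enc, hencdef⟩ : ∃ enc : Fin M₁ × Fin M₂ → Fin n → X,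
    enc = fun m => c.encoder m.1 m.2 := ⟨_, rfl⟩
  have hμ : μ ∈ stdSimplex ℝ (Fin M₁ × Fin M₂) := by
    rw [hμdef]
    refine ⟨fun _ => by positivity, ?_⟩
    simp only [Finset.sum_const, Finset.card_univ, Fintype.card_prod, Fintype.card_fin,
      nsmul_eq_mul, Nat.cast_mul]
    field_simp
  have hP := W.blockMass_mem_stdSimplex enc hμ
  have herr := W.errorProb_eq_sum_blockMass c
  rw [← hμdef, ← hencdef] at herr
  have hfst := W.lawOf_blockMass_fst (μ := μ) enc
  have hN₁ := W.entropy_block_sub (μ := μ) enc Prod.fst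
  have hN₂ := W.entropy_block_sub (μ := μ) enc Prod.snd
  have hO₁ := W.entropy_block_output (μ := μ) enc Prod.fst
  have hO₂ := W.entropy_block_output (μ := μ) enc Prod.snd
  have hU := fun i => W.block_mem_entropyHull enc hμ i
    (U := fun ω => (ω.1.2, splitAt (fun (ω : (Fin M₁ × Fin M₂) × (Fin n → Y₁ × Y₂)) j =>
      (ω.2 j).1) (fun ω j => (ω.2 j).2) i ω)) fun m y b => by
        rw [splitAt_update]
  have hV := fun i => W.block_mem_entropyHull enc hμ i
    (U := fun ω => (ω.1.1, splitAt (fun (ω : (Fin M₁ × Fin M₂) × (Fin n → Y₁ × Y₂)) j =>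
      (ω.2 j).1) (fun ω j => (ω.2 j).2) i ω)) fun m y b => by
        rw [splitAt_update]
  set P := W.blockMass μ enc with hPdef
  clear_value P
  have hH₁₂ : entropy P Prod.fst = Real.logb 2 M₁ + Real.logb 2 M₂ := by
    rw [entropy_of_uniform fun a => by
      rw [hfst, hμdef, Fintype.card_prod, Fintype.card_fin, Fintype.card_fin, Nat.cast_mul]]
    rw [Fintype.card_prod, Fintype.card_fin, Fintype.card_fin, Nat.cast_mul,
      Real.logb_mul hM₁'.ne' hM₂'.ne']
  have hH₂ : entropy P (fun ω => ω.1.2) = Real.logb 2 M₂ := by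
    rw [entropy_of_uniform (α := Fin M₂) fun a => by
      rw [← lawOf_lawOf P Prod.fst Prod.snd, hfst, hμdef, lawOf_snd, Finset.sum_const,
        Finset.card_univ, Fintype.card_fin, Fintype.card_fin, nsmul_eq_mul]
      field_simp]
    rw [Fintype.card_fin]
  have hlog₁ : 0 ≤ Real.logb 2 M₁ := Real.logb_nonneg one_lt_two (by exact_mod_cast hM₁)
  have hlog₂ : 0 ≤ Real.logb 2 M₂ := Real.logb_nonneg one_lt_two (by exact_mod_cast hM₂)
  let y₁ : (Fin M₁ × Fin M₂) × (Fin n → Y₁ × Y₂) → Fin n → Y₁ := fun ω i => (ω.2 i).1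
  let y₂ : (Fin M₁ × Fin M₂) × (Fin n → Y₁ × Y₂) → Fin n → Y₂ := fun ω i => (ω.2 i).2
  have hF₁ : entropy P (fun ω => (ω.1.1, y₁ ω)) - entropy P y₁ ≤
      1 + W.errorProb c * Real.logb 2 M₁ := by
    have h := fano hP (fun ω => ω.1.1) y₁ c.decoder₁
    rw [Fintype.card_fin] at h
    refine h.trans ?_
    gcongr
    rw [herr]
    refine Finset.sum_le_sum fun ω _ => ?_
    split_ifs with h1 h2 h2
    · exact le_rfl
    · exact absurd (Or.inl h1) h2
    · exact hP.1 ω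
    · exact le_rfl
  have hF₂ : entropy P (fun ω => (ω.1.2, y₂ ω)) - entropy P y₂ ≤
      1 + W.errorProb c * Real.logb 2 M₂ := by
    have h := fano hP (fun ω => ω.1.2) y₂ c.decoder₂
    rw [Fintype.card_fin] at h
    refine h.trans ?_
    gcongr
    rw [herr]
    refine Finset.sum_le_sum fun ω _ => ?_
    split_ifs with h1 h2 h2
    · exact le_rfl
    · exact absurd (Or.inr h1) h2
    · exact hP.1 ω
    · exact le_rfl
  -- For the sum bounds, submodularity turns `H(W₁|Y₁ⁿ)` into the smaller `H(W₁|W₂,Y₁ⁿ)`, and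
  -- `H(W₂|Y₂ⁿ)` into `H(W₂|W₁,Y₂ⁿ)`.
  have hS₁ := entropy_seq_le hP y₁
  have hS₂ := entropy_seq_le hP y₂
  have hsub₁ := entropy_submodular hP (fun ω => ω.1.1) (fun ω => ω.1.2) y₁
  have hsub₂ := entropy_submodular hP (fun ω => ω.1.1) (fun ω => ω.1.2) y₂
  have hCU := csiszar_sum P (fun ω => ω.1.2) y₁ y₂
  have hCV := csiszar_sum P (fun ω => ω.1.1) y₁ y₂
  have hL := sum_splitAt_le hP (fun ω => ω.1.2) y₁ y₂
  have eq₁ : entropy P (fun ω => (ω.1.1, ω.1.2, y₁ ω)) = entropy P fun ω => (ω.1, y₁ ω) :=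
    entropy_congr P fun ω ω' => by simp [Prod.ext_iff (x := ω.1), and_assoc]
  have eq₂ : entropy P (fun ω => (ω.1.1, ω.1.2, y₂ ω)) = entropy P fun ω => (ω.1, y₂ ω) :=
    entropy_congr P fun ω ω' => by simp [Prod.ext_iff (x := ω.1), and_assoc]
  have hr : ∀ i x, 0 ≤ lawOf P (fun ω => enc ω.1 i) x := fun i x => lawOf_nonneg hP.1 _ x
  obtain ⟨z, hz, hz1, hza, hzb⟩ := W.exists_average hn hU
  obtain ⟨z', hz', hz1', hza', hzb'⟩ := W.exists_average hn hV
  have ho₁ := W.sum_outEntropy_le Prod.fst hn hr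
  have ho₂ := W.sum_outEntropy_le Prod.snd hn hr
  rw [← Finset.sum_congr rfl fun i _ => hO₁ i] at ho₁
  rw [← Finset.sum_congr rfl fun i _ => hO₂ i] at ho₂
  rw [← hz1] at ho₁ ho₂
  rw [W.sum_noiseEntropy_eq _ hn, ← hz1] at hN₁ hN₂
  rw [Finset.sum_sub_distrib] at hza hzb hza' hzb' hCU hCV hL
  -- The first bound is `I(W₂;Y₂ⁿ) ≤ H(Y₂ⁿ) - ∑ H(Y₂ᵢ|Uᵢ)`. The second bounds `I(W₂;Y₂ⁿ) +
  -- I(W₁;Y₁ⁿ|W₂)`, where `H(Y₁ⁿ|W₂) - H(Y₂ⁿ|W₂)` becomes single-letter by the Csiszár identity. The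
  -- third exchanges the receivers and uses `Vᵢ`.
  refine ⟨z, hz, z', hz', hz1.trans hz1'.symm, ?_, ?_, ?_⟩
  · linarith
  · linarith
  · linarith

end Converse

end BroadcastChannel

namespace BroadcastChannel

open FiniteEntropy

/-! ### Passage to the limit and removal of the second auxiliary. -/

section OuterBound

variable {X Y₁ Y₂ : Type*} [Fintype X] [Fintype Y₁] [Fintype Y₂] (W : BroadcastChannel X Y₁ Y₂)

theorem logb_ceil_two_rpow_bounds {x : ℝ} (hx : 0 ≤ x) :
    x ≤ Real.logb 2 ⌈(2 : ℝ) ^ x⌉₊ ∧ Real.logb 2 ⌈(2 : ℝ) ^ x⌉₊ ≤ x + 1 := by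
  have hpos : (0 : ℝ) < ⌈(2 : ℝ) ^ x⌉₊ := by exact_mod_cast ceil_two_rpow_pos x
  constructor
  · rw [Real.le_logb_iff_rpow_le one_lt_two hpos]
    exact Nat.le_ceil _
  · rw [Real.logb_le_iff_le_rpow one_lt_two hpos, Real.rpow_add_one two_ne_zero, mul_comm]
    exact ceil_two_rpow_le hx

theorem exists_entropyHull_of_achievable {R : ℝ × ℝ} (hR : W.Achievable R) {ε : ℝ} (hε : 0 < ε) :
    ∃ z ∈ W.entropyHull, ∃ z' ∈ W.entropyHull, z.1 = z'.1 ∧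
      R.2 - ε ≤ W.outEntropy Prod.snd z.1 - z.2.2 ∧
      R.1 + R.2 - ε ≤ W.outEntropy Prod.snd z.1 - z.2.2 + z.2.1 - W.noiseEntropy Prod.fst z.1 ∧
      R.1 + R.2 - ε ≤
        W.outEntropy Prod.fst z.1 - z'.2.1 + z'.2.2 - W.noiseEntropy Prod.snd z.1 := by
  obtain ⟨h₁, h₂, c, hc⟩ := hR
  set e : ℕ → ℝ := fun n => W.errorProb (c n) with he
  -- Fano's terms divided by `n`; the last summand pays for rounding the two message sets up, at
  -- most one bit each.
  have ht : Tendsto (fun n : ℕ => 2 / (n : ℝ) + e n * (R.1 + R.2) + e n * (2 / (n : ℝ))) atTop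
      (𝓝 0) := by
    have h2 := tendsto_const_div_atTop_nhds_zero_nat (2 : ℝ)
    simpa using (h2.add (hc.mul_const (R.1 + R.2))).add (hc.mul h2)
  obtain ⟨n, hnε, hn⟩ := ((ht.eventually (gt_mem_nhds hε)).and (eventually_gt_atTop 0)).exists
  have hn' : (0 : ℝ) < n := by exact_mod_cast hn
  have he0 : 0 ≤ e n := W.errorProb_nonneg _
  obtain ⟨z, hz, z', hz', h, ha, hb, hd⟩ := W.exists_entropyHull_of_code
    (ceil_two_rpow_pos _) (ceil_two_rpow_pos _) hn (c n)
  obtain ⟨l₁, u₁⟩ := logb_ceil_two_rpow_bounds (mul_nonneg hn'.le h₁)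
  obtain ⟨l₂, u₂⟩ := logb_ceil_two_rpow_bounds (mul_nonneg hn'.le h₂)
  change _ - (1 + e n * _) ≤ _ at ha
  change _ - (2 + e n * _) ≤ _ at hb hd
  have hε' : 2 + e n * (n * (R.1 + R.2) + 2) ≤ n * ε := by
    have : 2 + e n * (n * (R.1 + R.2) + 2) =
        n * (2 / (n : ℝ) + e n * (R.1 + R.2) + e n * (2 / (n : ℝ))) := by
      field_simp
      ring
    rw [this]
    exact mul_le_mul_of_nonneg_left hnε.le hn'.le
  have e1 : e n * Real.logb 2 ⌈(2 : ℝ) ^ (n * R.2)⌉₊ ≤ e n * (n * (R.1 + R.2) + 2) := by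
    refine mul_le_mul_of_nonneg_left (u₂.trans ?_) he0
    have := mul_nonneg hn'.le h₁
    linarith
  have e2 : e n * (Real.logb 2 ⌈(2 : ℝ) ^ (n * R.1)⌉₊ + Real.logb 2 ⌈(2 : ℝ) ^ (n * R.2)⌉₊) ≤
      e n * (n * (R.1 + R.2) + 2) := by
    refine mul_le_mul_of_nonneg_left ?_ he0
    linarith
  refine ⟨z, hz, z', hz', h, ?_, ?_, ?_⟩
  · refine le_of_mul_le_mul_left (le_trans ?_ ha) hn'
    linarith
  · refine le_of_mul_le_mul_left (le_trans ?_ hb) hn'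
    linarith
  · refine le_of_mul_le_mul_left (le_trans ?_ hd) hn'
    linarith

theorem nonneg_of_mem_capacityRegion {R : ℝ × ℝ} (hR : R ∈ W.capacityRegion) :
    0 ≤ R.1 ∧ 0 ≤ R.2 := by
  have hclosed : IsClosed {R : ℝ × ℝ | 0 ≤ R.1 ∧ 0 ≤ R.2} :=
    (isClosed_le continuous_const continuous_fst).inter
      (isClosed_le continuous_const continuous_snd)
  have hsub : {R | W.Achievable R} ⊆ {R : ℝ × ℝ | 0 ≤ R.1 ∧ 0 ≤ R.2} := fun R h =>
    And.intro h.1 h.2.1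
  exact closure_minimal hsub hclosed hR

/-- The smallest of the three slacks is continuous on the compact set of pairs with a common input
law and exceeds every negative number somewhere, so its maximum is nonnegative. This removes the `ε`
and the closure together. -/
theorem exists_entropyHull_of_mem_capacityRegion {R : ℝ × ℝ} (hR : R ∈ W.capacityRegion) :
    ∃ z ∈ W.entropyHull, ∃ z' ∈ W.entropyHull, z.1 = z'.1 ∧
      R.2 ≤ W.outEntropy Prod.snd z.1 - z.2.2 ∧
      R.1 + R.2 ≤ W.outEntropy Prod.snd z.1 - z.2.2 + z.2.1 - W.noiseEntropy Prod.fst z.1 ∧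
      R.1 + R.2 ≤ W.outEntropy Prod.fst z.1 - z'.2.1 + z'.2.2 - W.noiseEntropy Prod.snd z.1 := by
  let T : Set (((X → ℝ) × ℝ × ℝ) × ((X → ℝ) × ℝ × ℝ)) :=
    (W.entropyHull ×ˢ W.entropyHull) ∩ {t | t.1.1 = t.2.1}
  have hT : IsCompact T := (W.isCompact_entropyHull.prod W.isCompact_entropyHull).inter_right
    (isClosed_eq (by fun_prop) (by fun_prop))
  let φ : ((X → ℝ) × ℝ × ℝ) × ((X → ℝ) × ℝ × ℝ) → ℝ := fun t =>
    min (W.outEntropy Prod.snd t.1.1 - t.1.2.2 - R.2)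
      (min (W.outEntropy Prod.snd t.1.1 - t.1.2.2 + t.1.2.1 - W.noiseEntropy Prod.fst t.1.1 -
        (R.1 + R.2))
      (W.outEntropy Prod.fst t.1.1 - t.2.2.1 + t.2.2.2 - W.noiseEntropy Prod.snd t.1.1 -
        (R.1 + R.2)))
  have hφ : Continuous φ := by
    have c1 := W.continuous_outEntropy Prod.fst
    have c2 := W.continuous_outEntropy Prod.snd
    have c3 := W.continuous_noiseEntropy Prod.fst
    have c4 := W.continuous_noiseEntropy Prod.snd
    fun_prop
  have happrox : ∀ ε : ℝ, 0 < ε → ∃ t ∈ T, -ε ≤ φ t := by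
    intro ε hε
    obtain ⟨R', hR', hdist⟩ := Metric.mem_closure_iff.1 hR (ε / 4) (by positivity)
    obtain ⟨z, hz, z', hz', h, ha, hb, hd⟩ :=
      W.exists_entropyHull_of_achievable hR' (half_pos hε)
    rw [Prod.dist_eq, max_lt_iff, Real.dist_eq, Real.dist_eq, abs_lt, abs_lt] at hdist
    refine ⟨(z, z'), ⟨⟨hz, hz'⟩, h⟩, le_min ?_ (le_min ?_ ?_)⟩
    · dsimp only
      linarith
    · dsimp only
      linarith
    · dsimp only
      linarith
  obtain ⟨t₁, ht₁, -⟩ := happrox 1 one_pos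
  obtain ⟨t, ht, hmax⟩ := hT.exists_isMaxOn ⟨t₁, ht₁⟩ hφ.continuousOn
  have h0 : 0 ≤ φ t := by
    refine le_of_forall_pos_le_add fun ε hε => ?_
    obtain ⟨t', ht', h'⟩ := happrox ε hε
    have := hmax ht'
    simp only [Set.mem_ofPred_eq] at this
    linarith
  obtain ⟨ha, hb⟩ := le_min_iff.1 h0
  obtain ⟨hb, hd⟩ := le_min_iff.1 hb
  exact ⟨t.1, ht.1.1, t.2, ht.1.2, ht.2, by linarith, by linarith, by linarith⟩

/-- Two auxiliary variables with the same input distribution can be realised jointly. -/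
theorem exists_coupling {A B : Type*} [Fintype A] [Fintype B] {p : A × X → ℝ} {p' : B × X → ℝ}
    (hp : p ∈ stdSimplex ℝ (A × X)) (hp' : p' ∈ stdSimplex ℝ (B × X))
    (h : lawOf p Prod.snd = lawOf p' Prod.snd) :
    ∃ q ∈ stdSimplex ℝ ((A × B) × X), mapAux q Prod.fst = p ∧ mapAux q Prod.snd = p' := by
  classical
  let s : X × B → ℝ := lawOf p' Prod.swap
  have hs : s ∈ stdSimplex ℝ (X × B) := lawOf_mem_stdSimplex hp' _
  have hs_apply : ∀ x b, s (x, b) = p' (b, x) := by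
    intro x b
    simp only [s, lawOf_eq_sum_ite]
    rw [Finset.sum_eq_single (b, x)]
    · simp
    · rintro ⟨b', x'⟩ _ hne
      refine if_neg fun h => hne ?_
      simp only [Prod.swap_prod_mk, Prod.mk.injEq] at h ⊢
      exact ⟨h.2, h.1⟩
    · simp
  have hκ := condKernel_mem_stdSimplex hs
  -- `A` and `B` are made conditionally independent given `X`.
  let q : (A × B) × X → ℝ := fun t => p (t.1.1, t.2) * condKernel s t.2 t.1.2
  have hq0 : ∀ t, 0 ≤ q t := fun t => mul_nonneg (hp.1 _) ((hκ _).1 _)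
  have hfst : mapAux q Prod.fst = p := by
    ext ⟨a, x⟩
    rw [mapAux, lawOf_eq_sum_ite, Fintype.sum_prod_type_right,
      Finset.sum_eq_single x, Fintype.sum_prod_type, Finset.sum_eq_single a]
    · simp only [if_true, q, ← Finset.mul_sum, (hκ x).2, mul_one]
    · intro a' _ ha
      simp [ha]
    · simp
    · intro x' _ hx
      simp [hx]
    · simp
  have hsnd : mapAux q Prod.snd = p' := by
    ext ⟨b, x⟩
    rw [mapAux, lawOf_eq_sum_ite, Fintype.sum_prod_type_right,
      Finset.sum_eq_single x, Fintype.sum_prod_type_right, Finset.sum_eq_single b]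
    · simp only [if_true, q, ← Finset.sum_mul]
      rw [← lawOf_snd, h, lawOf_snd, ← hs_apply x b, ← lawOf_fst_mul_condKernel hs.1, lawOf_fst]
      simp only [hs_apply]
    · intro a' _ ha
      simp [ha]
    · simp
    · intro x' _ hx
      simp [hx]
    · simp
  refine ⟨q, ⟨hq0, ?_⟩, hfst, hsnd⟩
  rw [← sum_lawOf q fun t => (t.1.1, t.2)]
  exact (congrArg (fun r => ∑ t, r t) hfst).trans hp.2

/-- The bounds involve `(U,X)` and `(V,X)` separately, so any coupling of the two auxiliaries
supplies the triple to which sufficiency applies; only four of the ten inequalities enter. -/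
theorem capacityRegion_subset_superpositionRegion {D : Set (X → ℝ)}
    (hD : W.EssentiallyMoreCapableOn D) : W.capacityRegion ⊆ W.superpositionRegion D := by
  intro R hR
  obtain ⟨hR₁, hR₂⟩ := W.nonneg_of_mem_capacityRegion hR
  obtain ⟨z, hz, z', hz', hzz, h_a, h_b, h_c⟩ := W.exists_entropyHull_of_mem_capacityRegion hR
  obtain ⟨k, p, hp, hp1, hp2, hp3⟩ := W.exists_of_mem_entropyHull hz
  obtain ⟨l, p', hp', hp1', hp2', hp3'⟩ := W.exists_of_mem_entropyHull hz'
  obtain ⟨s, hs, hs1, hs2⟩ := exists_coupling hp hp' (by rw [hp1, hp1', hzz])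
  have hsX : lawOf s Prod.snd = z.1 := by rw [← hp1, ← hs1, lawOf_mapAux_snd]
  obtain ⟨k', l', q, hq, hqD, -, a2, a3, -, c1, -, -, c4, -, -⟩ := hD.1.2 k l s hs
  -- The comparison of the receivers is applied to the new `V`, whose input law lies in `D`; with
  -- the chain rule `t1` it bounds the third right-hand side by `I(X;Y₁)`.
  have hcap := hD.2 l' (mapAux q Prod.snd) (mapAux_mem_stdSimplex hq _)
    (by rwa [lawOf_mapAux_snd])
  rw [condInfo₁_mapAux, condInfo₂_mapAux] at hcap
  change W.condInfo₂ q Prod.snd ≤ W.condInfo₁ q Prod.snd at hcap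
  have s2 : W.auxInfo₂ s Prod.fst = W.outEntropy Prod.snd z.1 - z.2.2 := by
    rw [← hsX, ← hp3, ← hs1]
    exact W.mutualInfo_aux Prod.snd s Prod.fst
  have s1 : W.condInfo₁ s Prod.fst = z.2.1 - W.noiseEntropy Prod.fst z.1 := by
    rw [← hsX, ← hp2, ← hs1]
    exact W.condMutualInfo_aux Prod.fst s Prod.fst
  have s3 : W.auxInfo₁ s Prod.snd = W.outEntropy Prod.fst z.1 - z'.2.1 := by
    rw [← hsX, ← hp2', ← hs2]
    exact W.mutualInfo_aux Prod.fst s Prod.snd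
  have s4 : W.condInfo₂ s Prod.snd = z'.2.2 - W.noiseEntropy Prod.snd z.1 := by
    rw [← hsX, ← hp3', ← hs2]
    exact W.condMutualInfo_aux Prod.snd s Prod.snd
  have t1 : W.auxInfo₁ q Prod.snd + W.condInfo₁ q Prod.snd = W.inputInfo₁ q := by
    have e1 := W.mutualInfo_aux Prod.fst q Prod.snd
    have e2 := W.condMutualInfo_aux Prod.fst q Prod.snd
    have e3 := W.mutualInfo_input Prod.fst q
    rw [auxInfo₁, condInfo₁, inputInfo₁, e1, e2, e3]
    ring
  refine ⟨hR₁, hR₂, k', mapAux q Prod.fst, mapAux_mem_stdSimplex hq _,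
    by rwa [lawOf_mapAux_snd], ?_, ?_, ?_⟩
  · rw [auxInfo₂_mapAux]
    change R.2 ≤ W.auxInfo₂ q Prod.fst
    linarith
  · rw [auxInfo₂_mapAux, condInfo₁_mapAux]
    change R.1 + R.2 ≤ W.auxInfo₂ q Prod.fst + W.condInfo₁ q Prod.fst
    linarith
  · rw [inputInfo₁_mapAux]
    linarith

end OuterBound

end BroadcastChannel

theorem mainTheorem2 {X Y₁ Y₂ : Type*} [Fintype X] [Fintype Y₁] [Fintype Y₂]
    (W : BroadcastChannel X Y₁ Y₂) (D : Set (X → ℝ)) (hD : W.EssentiallyMoreCapableOn D) :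
    W.capacityRegion = W.superpositionRegion D :=
  (W.capacityRegion_subset_superpositionRegion hD).antisymm
    (W.superpositionRegion_subset_capacityRegion D)
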